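/- **Notation.** Let $e(t)=e^{2\pi i t}$. Fix $\lambda=(\lambda_1,\lambda_2,\lambda_3)\in\mathbb C^3$ with $\sum_j\lambda_j=0$ and $\delta=(\delta_1,\delta_2,\delta_3)\in(\mathbb Z/2\mathbb Z)^3$ with $\sum_j\delta_j=0$. Let $P$ be the group of invertible lower triangular real $3\times3$ matrices, and let $\omega_{\lambda,\delta}(p)=\frac{a_3}{a_1}\prod_j a_j^{\lambda_j}\varepsilon_j^{\delta_j}$ for $p\in P$ with diagonal entries $\varepsilon_ja_j$, $a_j>0$, $\varepsilon_j=\pm1$. Let $V^\infty_{\lambda,\delta}$ be the Fréchet space of all $f\in C^\infty(\mathrm{GL}(3,\mathbb R))$ with $f(gp)=\omega_{\lambda,\delta}(p^{-1})f(g)$ for $p\in P$, on which $\mathrm{GL}(3,\mathbb R)$ acts by left translation, and let $V^{-\infty}_{\lambda,\delta}$, the space of distribution vectors, be the continuous dual of $V^\infty_{-\lambda,\delta}$. Let $\tau\in V^{-\infty}_{\lambda,\delta}$ be invariant under $\mathrm{GL}(3,\mathbb Z)$. Let $N$ be the group of upper triangular unipotent matrices, identified with $\mathbb R^3$ by the coordinates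 $x=n_{12}$, $y=n_{23}$, $z=n_{13}$, and $N_{\mathbb Z}$ its subgroup of integral matrices. Restricted to $N$, $\tau$ is a distribution $\tau(x,y,z)$ on $N_{\mathbb Z}\backslash N$; it is periodic in $(y,z)$ and, in the coordinates $(x,y,w)$ with $w=z-xy$, periodic in $(x,w)$. Define $c_{r,s}=\int_{N_{\mathbb Z}\backslash N}\tau(x,y,z)\,e(-rx-sy)\,dx\,dy\,dz$ for $r,s\in\mathbb Z$ and, for $n\in\mathbb Z-\{0\}$ and $k\in\mathbb Z$, distributions $\sigma_{n,k}$, $\rho_{n,k}$ on $\mathbb R$ by: $\sigma_{n,k}(x+\frac kn)$ is the coefficient of $e(nz+ky)$ in the Fourier series of $\tau$ in $(y,z)$, and $\rho_{n,k}(\frac kn-y)$ is the coefficient of $e(nw+kx)$ in the Fourier series of $\tau$ in $(x,w)$. Thus $$\tau=\sum_{r,s}c_{r,s}e(rx+sy)+\sum_{n\ne0}\sum_{k\in\mathbb Z}e(nz+ky)\,\sigma_{n,k}(x+\tfrac kn)=\sum_{r,s}c_{r,s}e(rx+sy)+\sum_{n\neq0}\sum_{k\in\mathbb Z}e(n(z-xy)+kx)\,\rho_{n,k}(\tfrac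 kn-y).$$ **Proposition.** $\sigma_{n,k}$ and $\rho_{n,k}$ depend only on $n$ and on $k$ modulo $n$. Let $a,\bar a,c,q$ be integers with $c\ne0$, $q\neq0$ and $a\bar a\equiv1\pmod c$. Then, as identities between distributions on $\mathbb R-\{0\}$ (all series converging in the sense of distributions), a) $\sigma_{cq,aq}(x)=(\operatorname{sgn}cx)^{\delta_3}|cx|^{\lambda_1-\lambda_2-1}\sum_{r\in\mathbb Z}c_{r,q}\,e\!\left(\frac{r\bar a}{c}-\frac{r}{c^2x}\right)$; b) $\rho_{cq,aq}(y)=(\operatorname{sgn}cy)^{\delta_1}|cy|^{\lambda_2-\lambda_3-1}\sum_{s\in\mathbb Z}c_{q,s}\,e\!\left(\frac{s}{c^2y}-\frac{s\bar a}{c}\right)$; c) $\sum_rc_{r,0}\,e(rx)$ equals $|x|^{\lambda_1-\lambda_2-1}\sum_rc_{r,0}\,e(-r/x)$ if $\delta_3=0$, and equals $0$ if $\delta_3=1$; d) $\sum_sc_{0,s}\,e(sy)$ equals $|y|^{\lambda_2-\lambda_3-1}\sum_sc_{0,s}\,e(-s/y)$ if $\delta_1=0$, and equals $0$ if $\delta_1=1$.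 **Corollary.** For $\mu\in\mathbb C$, $\eta\in\mathbb Z/2\mathbb Z$ let $W^\infty_{\mu,\eta}$ be the space of $f\in C^\infty(\mathrm{SL}(2,\mathbb R))$ with $f\big(g\left(\begin{smallmatrix}1/t&0\\u&t\end{smallmatrix}\right)\big)=(\operatorname{sgn}t)^\eta|t|^{\mu-1}f(g)$, with $\mathrm{SL}(2,\mathbb R)$ acting by left translation; $f$ is identified with the function $x\mapsto f\left(\begin{smallmatrix}1&x\\0&1\end{smallmatrix}\right)$ on $\mathbb R$. Let $W^{-\infty}_{\mu,\eta}$ be the continuous dual of $W^\infty_{-\mu,\eta}$, with the dual action $\psi_{\mu,\eta}$, so that on $\mathbb R$, where it makes sense, $(\psi_{\mu,\eta}(g^{-1})f)(x)=(\operatorname{sgn}(\gamma x+d))^\eta|\gamma x+d|^{\mu-1}f\big(\frac{\alpha x+\beta}{\gamma x+d}\big)$ for $g=\left(\begin{smallmatrix}\alpha&\beta\\\gamma&d\end{smallmatrix}\right)$. Elements of $W^{-\infty}_{\mu,\eta}$ restrict to distributions on $\mathbb R$. For all $n\neq0$, $k$ and all $q\in\mathbb Z$, the distributions $\sigma_{n,k}$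 and $\sum_rc_{r,q}e(rx)$ on $\mathbb R$ extend naturally to vectors in $W^{-\infty}_{\lambda_1-\lambda_2,\delta_3}$, and $\rho_{n,k}$ and $\sum_sc_{q,s}e(sy)$ to vectors in $W^{-\infty}_{\lambda_2-\lambda_3,\delta_1}$; again the extensions of $\sigma_{n,k}$, $\rho_{n,k}$ depend only on $n$ and on $k$ modulo $n$. The extensions are obtained, up to a translation $x\mapsto x-\frac kn$ for $\sigma_{n,k}$ and the substitution $y\mapsto\frac kn-y$ for $\rho_{n,k}$, as follows: take the part of $\tau$ that transforms by the character $e(ky+nz)$ (with $(n,k)=(0,q)$ for $\sum_rc_{r,q}e(rx)$) of the group $\{x=0\}\subset N$ and restrict it to the upper left copy of $\mathrm{SL}(2,\mathbb R)$, respectively take the part that transforms by the character $e(kx+nz)$ (with $(n,k)=(0,q)$ for $\sum_sc_{q,s}e(sy)$) of the group $\{y=0\}\subset N$ and restrict it to the lower right copy of $\mathrm{SL}(2,\mathbb R)$. With these extensions, for $a,\bar a,c,q$ as above, one has the identities of vectors $$\sum_rc_{r,q}e(rx)=\psi_{\lambda_1-\lambda_2,\delta_3}\left(\begin{smallmatrix}\bar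 a&-c^{-1}\\c&0\end{smallmatrix}\right)\sigma_{cq,aq},\qquad \sum_sc_{q,s}e(-sy)=\psi_{\lambda_2-\lambda_3,\delta_1}\left(\begin{smallmatrix}\bar a&-c^{-1}\\c&0\end{smallmatrix}\right)\rho_{cq,aq},$$ whose right-hand sides depend only on $\bar a$ modulo $c$; if $\delta_3=0$, the vector $\sum_rc_{r,0}e(rx)$ is fixed by $\psi_{\lambda_1-\lambda_2,\delta_3}\left(\begin{smallmatrix}0&1\\-1&0\end{smallmatrix}\right)$, and if $\delta_1=0$, the vector $\sum_sc_{0,s}e(sy)$ is fixed by $\psi_{\lambda_2-\lambda_3,\delta_1}\left(\begin{smallmatrix}0&1\\-1&0\end{smallmatrix}\right)$. -/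

import Mathlib

open scoped ContDiff Topology MatrixGroups
open Complex TopologicalSpace

noncomputable section

attribute [local instance] Matrix.normedAddCommGroup Matrix.normedSpace

namespace GL3Automorphic

/-! ### Elementary functions -/

/-- The additive character `e(t) = exp(2πit)`. -/
def e (t : ℝ) : ℂ := Complex.exp (2 * Real.pi * I * t)

/-- The quasi-character `t ↦ (sgn t)^η |t|^s` of `ℝ*`, with `η ∈ ℤ/2ℤ` and `s ∈ ℂ`
(only its values at `t ≠ 0` matter). -/
def quasiChar (η : ZMod 2) (s : ℂ) (t : ℝ) : ℂ :=
  (if η = 0 then 1 else (Real.sign t : ℂ)) * ((|t| : ℝ) : ℂ) ^ s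

lemma sign_mul_aux (a b : ℝ) : Real.sign (a * b) = Real.sign a * Real.sign b := by
  rcases lt_trichotomy a 0 with ha | ha | ha <;> rcases lt_trichotomy b 0 with hb | hb | hb <;>
    simp [ha, hb, Real.sign_of_neg, Real.sign_of_pos, mul_pos_of_neg_of_neg, mul_neg_of_neg_of_pos,
      mul_neg_of_pos_of_neg]

lemma sign_sq_aux {a : ℝ} (ha : a ≠ 0) : Real.sign a * Real.sign a = 1 := by
  rcases lt_or_gt_of_ne ha with h | h <;> simp [h, Real.sign_of_neg, Real.sign_of_pos]

lemma quasiChar_mul (η : ZMod 2) (s : ℂ) (a b : ℝ) :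
    quasiChar η s (a * b) = quasiChar η s a * quasiChar η s b := by
  unfold quasiChar
  rw [abs_mul, ofReal_mul, mul_cpow_ofReal_nonneg (abs_nonneg _) (abs_nonneg _), sign_mul_aux]
  split_ifs <;> push_cast <;> ring

lemma quasiChar_add (η η' : ZMod 2) (s s' : ℂ) {a : ℝ} (ha : a ≠ 0) :
    quasiChar (η + η') (s + s') a = quasiChar η s a * quasiChar η' s' a := by
  unfold quasiChar
  have h0 : ((|a| : ℝ) : ℂ) ≠ 0 := by simpa using ha
  have hs : ((Real.sign a : ℝ) : ℂ) * (Real.sign a : ℝ) = 1 := by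
    exact_mod_cast sign_sq_aux ha
  rw [cpow_add _ _ h0]
  have key : ∀ x y : ZMod 2, (if x + y = 0 then (1 : ℂ) else (Real.sign a : ℂ)) =
      (if x = 0 then (1 : ℂ) else (Real.sign a : ℂ)) *
        (if y = 0 then (1 : ℂ) else (Real.sign a : ℂ)) := by
    have hz : ∀ x : ZMod 2, x = 0 ∨ x = 1 := by decide
    have h11 : (1 + 1 : ZMod 2) = 0 := by decide
    intro x y
    rcases hz x with rfl | rfl <;> rcases hz y with rfl | rfl <;> simp [hs, h11]
  rw [key]
  ring

lemma quasiChar_ne_zero (η : ZMod 2) (s : ℂ) {a : ℝ} (ha : a ≠ 0) : quasiChar η s a ≠ 0 := by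
  unfold quasiChar
  have h0 : ((|a| : ℝ) : ℂ) ≠ 0 := by simpa using ha
  refine mul_ne_zero ?_ (by rw [Ne, cpow_eq_zero_iff]; tauto)
  split_ifs
  · exact one_ne_zero
  · intro h
    have := sign_sq_aux ha
    rw [ofReal_eq_zero.mp h] at this
    simp at this

lemma quasiChar_one (η : ZMod 2) (s : ℂ) : quasiChar η s 1 = 1 := by
  simp [quasiChar, Real.sign_one]

lemma contDiffAt_quasiChar (η : ZMod 2) (s : ℂ) {a : ℝ} (ha : a ≠ 0) :
    ContDiffAt ℝ ∞ (quasiChar η s) a := by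
  have h1 : ContDiffAt ℝ ∞ (fun t : ℝ => Complex.exp ((Real.log t : ℂ) * s)) a := by
    refine ContDiffAt.cexp (ContDiffAt.mul ?_ contDiffAt_const)
    exact (Complex.ofRealCLM.contDiff.contDiffAt).comp a (Real.contDiffAt_log.2 ha)
  have h2 : ContDiffAt ℝ ∞ (fun t : ℝ => (if η = 0 then 1 else (Real.sign a : ℂ)) *
      Complex.exp ((Real.log t : ℂ) * s)) a := contDiffAt_const.mul h1
  refine h2.congr_of_eventuallyEq ?_
  have hs : ∀ᶠ t in 𝓝 a, Real.sign t = Real.sign a ∧ t ≠ 0 := by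
    rcases lt_or_gt_of_ne ha with h | h
    · filter_upwards [eventually_lt_nhds h] with t ht
      exact ⟨by rw [Real.sign_of_neg ht, Real.sign_of_neg h], ht.ne⟩
    · filter_upwards [eventually_gt_nhds h] with t ht
      exact ⟨by rw [Real.sign_of_pos ht, Real.sign_of_pos h], ht.ne'⟩
  filter_upwards [hs] with t ht
  have h0 : ((|t| : ℝ) : ℂ) ≠ 0 := by simpa using ht.2
  simp only [quasiChar, ht.1]
  rw [cpow_def_of_ne_zero h0, ← ofReal_log (abs_nonneg _), Real.log_abs]

/-! ### Test functions -/

/-- Complex-valued smooth functions with compact support on `E`. -/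
abbrev Test (E : Type*) [NormedAddCommGroup E] [NormedSpace ℝ E] : Type _ :=
  TestFunction (⊤ : Opens E) ℂ ⊤

section Test

variable {E E' : Type*} [NormedAddCommGroup E] [NormedSpace ℝ E]
  [NormedAddCommGroup E'] [NormedSpace ℝ E']

/-- Composition of a test function with a smooth homeomorphism. -/
def Test.compHomeo (φ : Test E) (h : E' ≃ₜ E) (hh : ContDiff ℝ ∞ h) : Test E' where
  toFun x := φ (h x)
  contDiff' := φ.contDiff.comp hh
  hasCompactSupport' := φ.hasCompactSupport.comp_homeomorph h
  tsupport_subset' := fun _ _ => trivial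

/-- The tensor product `(x, y) ↦ φ(x) Φ(y)` of two test functions. -/
def Test.tensor (φ : Test E) (Φ : Test E') : Test (E × E') where
  toFun p := φ p.1 * Φ p.2
  contDiff' := (φ.contDiff.comp contDiff_fst).mul (Φ.contDiff.comp contDiff_snd)
  hasCompactSupport' := by
    refine HasCompactSupport.intro (φ.hasCompactSupport.isCompact.prod
      Φ.hasCompactSupport.isCompact) ?_
    rintro ⟨x, y⟩ hxy
    by_cases hx : x ∈ tsupport φ
    · have hy : y ∉ tsupport Φ := fun hy => hxy ⟨hx, hy⟩
      simp [image_eq_zero_of_notMem_tsupport hy]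
    · simp [image_eq_zero_of_notMem_tsupport hx]
  tsupport_subset' := fun _ _ => trivial

/-- Product of a test function with a smooth function. -/
def Test.mulSmooth (φ : Test E) (u : E → ℂ) (hu : ContDiff ℝ ∞ u) : Test E where
  toFun x := u x * φ x
  contDiff' := hu.mul φ.contDiff
  hasCompactSupport' := φ.hasCompactSupport.mul_left
  tsupport_subset' := fun _ _ => trivial

end Test

lemma contDiff_e {E : Type*} [NormedAddCommGroup E] [NormedSpace ℝ E] {u : E → ℝ}
    (hu : ContDiff ℝ ∞ u) : ContDiff ℝ ∞ (fun x => e (u x)) := by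
  unfold e
  exact (contDiff_const.mul (Complex.ofRealCLM.contDiff.comp hu)).cexp

/-- A smooth function with support in `[-1, 1]` whose integral translates sum up to `1`. Pairing an
`ℤ`-periodic distribution with `χ · F` is the same as pairing it over `ℝ/ℤ` with the `ℤ`-periodic
smooth function `F`. -/
def cutoffFun (t : ℝ) : ℝ := Real.smoothTransition (t + 1) - Real.smoothTransition t

lemma cutoffFun_eq_zero {t : ℝ} (ht : t ∉ Set.Icc (-1 : ℝ) 1) : cutoffFun t = 0 := by
  unfold cutoffFun
  rcases lt_or_ge t (-1) with h | h
  · rw [Real.smoothTransition.zero_of_nonpos (by linarith),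
      Real.smoothTransition.zero_of_nonpos (by linarith), sub_zero]
  · have : 1 < t := by
      by_contra h'
      exact ht ⟨h, not_lt.1 h'⟩
    rw [Real.smoothTransition.one_of_one_le (by linarith),
      Real.smoothTransition.one_of_one_le (by linarith), sub_self]

lemma cutoffFun_hasSum (t : ℝ) : HasSum (fun m : ℤ => cutoffFun (t + m)) 1 := by
  set k : ℤ := ⌈t⌉ with hk
  have h1 : t ≤ k := Int.le_ceil t
  have h2 : (k : ℝ) < t + 1 := Int.ceil_lt_add_one t
  have hs : HasSum (fun m : ℤ => cutoffFun (t + m))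
      (∑ m ∈ ({-k, -k - 1, -k + 1} : Finset ℤ), cutoffFun (t + m)) :=
    hasSum_sum_of_ne_finset_zero (by
      intro m hm
      apply cutoffFun_eq_zero
      rintro ⟨h3, h4⟩
      simp only [Finset.mem_insert, Finset.mem_singleton, not_or] at hm
      have h5 : -k - 2 < m := by
        have : ((-k - 2 : ℤ) : ℝ) < m := by push_cast; linarith
        exact_mod_cast this
      have h6 : m < -k + 2 := by
        have : (m : ℝ) < ((-k + 2 : ℤ) : ℝ) := by push_cast; linarith
        exact_mod_cast this
      omega)
  convert hs using 1
  rw [Finset.sum_insert (by simp; omega), Finset.sum_insert (by simp; omega), Finset.sum_singleton]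
  unfold cutoffFun
  push_cast
  rw [show t + (-(k : ℝ) + 1) + 1 = t - k + 2 by ring, show t + (-(k : ℝ) + 1) = t - k + 1 by ring,
    show t + -(k : ℝ) + 1 = t - k + 1 by ring, show t + (-(k : ℝ) - 1) + 1 = t + -k by ring,
    Real.smoothTransition.one_of_one_le (x := t - k + 2) (by linarith),
    Real.smoothTransition.zero_of_nonpos (x := t + (-(k : ℝ) - 1)) (by linarith)]
  ring

/-- `cutoffFun` as a test function. -/
def cutoff : Test ℝ where
  toFun t := (cutoffFun t : ℂ)
  contDiff' := by
    refine Complex.ofRealCLM.contDiff.comp ?_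
    exact (Real.smoothTransition.contDiff.comp (contDiff_id.add contDiff_const)).sub
      Real.smoothTransition.contDiff
  hasCompactSupport' := HasCompactSupport.intro isCompact_Icc (fun t ht => by
    rw [cutoffFun_eq_zero ht, ofReal_zero])
  tsupport_subset' := fun _ _ => trivial

/-- The test function `χ(u) χ(v) e(-(k u + n v))` of `(u, v) ∈ ℝ²`. -/
def torusTest (k n : ℤ) : Test (ℝ × ℝ) :=
  (Test.tensor cutoff cutoff).mulSmooth (fun p => e (-(k * p.1 + n * p.2))) (contDiff_e (by fun_prop))


/-! ### The principal series of `GL(3, ℝ)` -/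

abbrev Mat3 : Type := Matrix (Fin 3) (Fin 3) ℝ

lemma contDiff_entry (i j : Fin 3) : ContDiff ℝ ∞ (fun g : Mat3 => g i j) :=
  contDiff_apply_apply ℝ ℝ i j

/-- Lower triangular matrices. -/
def IsLower (p : Mat3) : Prop := ∀ i j, i < j → p i j = 0

/-- The character `ω_{λ,δ}` of the group `P` of invertible lower triangular matrices: if `p` has
diagonal entries `ε_j a_j` with `a_j > 0` and `ε_j = ±1`, its value is
`(a₃ / a₁) ∏_j a_j ^ λ_j ε_j ^ δ_j`. -/
def inducingChar (lam : Fin 3 → ℂ) (del : Fin 3 → ZMod 2) (p : Mat3) : ℂ :=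
  ((|p 2 2| / |p 0 0| : ℝ) : ℂ) * ∏ j, quasiChar (del j) (lam j) (p j j)

/-- The space `V_{λ,δ}^∞` of smooth functions `f` on `GL(3, ℝ)` such that
`f(g p) = ω_{λ,δ}(p⁻¹) f(g)` for `p ∈ P`. Functions on `GL(3, ℝ)`, an open subset of the space of
matrices, are extended by zero to all matrices. -/
def SmoothVector (lam : Fin 3 → ℂ) (del : Fin 3 → ZMod 2) : Submodule ℂ (Mat3 → ℂ) where
  carrier := {f | (∀ g, g.det = 0 → f g = 0) ∧ ContDiffOn ℝ ∞ f {g | g.det ≠ 0} ∧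
    ∀ g p : Mat3, g.det ≠ 0 → p.det ≠ 0 → IsLower p → f (g * p) = (inducingChar lam del p)⁻¹ * f g}
  add_mem' := by
    rintro f f' ⟨h1, h2, h3⟩ ⟨h1', h2', h3'⟩
    refine ⟨fun g hg => by simp [h1 g hg, h1' g hg], h2.add h2', fun g p hg hp hl => ?_⟩
    simp only [Pi.add_apply, h3 g p hg hp hl, h3' g p hg hp hl, mul_add]
  zero_mem' := ⟨fun _ _ => rfl, contDiffOn_const, fun _ _ _ _ _ => by simp⟩
  smul_mem' := by
    rintro c f ⟨h1, h2, h3⟩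
    refine ⟨fun g hg => by simp [h1 g hg], contDiffOn_const.smul h2, fun g p hg hp hl => ?_⟩
    simp only [Pi.smul_apply, h3 g p hg hp hl, smul_eq_mul]
    ring

/-- The space `V_{λ,δ}^{-∞}` of distribution vectors: continuous linear functionals on the Fréchet
space `V_{-λ,δ}^∞`, whose topology is that of uniform convergence on compact subsets of `GL(3, ℝ)`
of the functions and all their derivatives. A vector `u ∈ V_{λ,δ}^∞` is identified with the
functional `f ↦ ∫_N u(n) f(n) dn`. -/
structure DistVector (lam : Fin 3 → ℂ) (del : Fin 3 → ZMod 2) where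
  toLin : SmoothVector (-lam) del →ₗ[ℂ] ℂ
  continuous' : ∃ (K : Set Mat3) (m : ℕ) (C : ℝ), IsCompact K ∧ K ⊆ {g | g.det ≠ 0} ∧
    ∀ (f : SmoothVector (-lam) del) (B : ℝ), 0 ≤ B →
      (∀ i ≤ m, ∀ g ∈ K, ‖iteratedFDeriv ℝ i (f : Mat3 → ℂ) g‖ ≤ B) → ‖toLin f‖ ≤ C * B

/-- Left translation `f ↦ (g ↦ f(γ g))`, that is, the action of `γ⁻¹` on `V_{λ,δ}^∞`. -/
def SmoothVector.translate {lam : Fin 3 → ℂ} {del : Fin 3 → ZMod 2} (γ : GL (Fin 3) ℝ)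
    (f : SmoothVector lam del) : SmoothVector lam del :=
  ⟨fun g => f.1 ((γ : Mat3) * g), by
    obtain ⟨f, h1, h2, h3⟩ := f
    have hγ : (γ : Mat3).det ≠ 0 := γ.det_ne_zero
    refine ⟨fun g hg => h1 _ (by rw [Matrix.det_mul, hg, mul_zero]), ?_, fun g p hg hp hl => ?_⟩
    · refine h2.comp (ContDiff.contDiffOn ?_) (fun g hg => ?_)
      · exact (LinearMap.mulLeft ℝ (γ : Mat3)).toContinuousLinearMap.contDiff
      · simp only [Set.mem_ofPred_eq, Matrix.det_mul] at hg ⊢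
        exact mul_ne_zero hγ hg
    · change f ((γ : Mat3) * (g * p)) = _ * f ((γ : Mat3) * g)
      rw [← Matrix.mul_assoc]
      exact h3 _ p (by rw [Matrix.det_mul]; exact mul_ne_zero hγ hg) hp hl⟩

/-- Invariance of a distribution vector under `GL(3, ℤ)`: `π_{λ,δ}(γ) τ = τ` for all `γ`. -/
def DistVector.IsGL3ZInvariant {lam : Fin 3 → ℂ} {del : Fin 3 → ZMod 2}
    (τ : DistVector lam del) : Prop :=
  ∀ (γ : GL (Fin 3) ℤ) (f : SmoothVector (-lam) del),
    τ.toLin (SmoothVector.translate (Matrix.GeneralLinearGroup.map (Int.castRingHom ℝ) γ) f) = τ.toLin f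

/-! ### The principal series of `SL(2, ℝ)` -/

/-- The linear action of a `2 × 2` matrix on column vectors. -/
def act2 (A : Matrix (Fin 2) (Fin 2) ℝ) (v : ℝ × ℝ) : ℝ × ℝ :=
  (A 0 0 * v.1 + A 0 1 * v.2, A 1 0 * v.1 + A 1 1 * v.2)

/-- The space `W_{μ,η}^∞` of smooth functions `f` on `SL(2, ℝ)` which transform by
`f(g (1/a, 0; c, a)) = (sgn a)^η |a|^(μ-1) f(g)`. Such an `f` depends only on the second column
of `g`, so `f(g) = F(g e₂)` for a unique smooth function `F` on `ℝ² - {0}` with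
`F(t v) = (sgn t)^η |t|^(μ-1) F(v)`; the elements of the space are these `F`, extended by zero to the
origin. The function on `ℝ` corresponding to `F` is `x ↦ F(x, 1)`. -/
def SL2Smooth (μ : ℂ) (η : ZMod 2) : Submodule ℂ (ℝ × ℝ → ℂ) where
  carrier := {F | F 0 = 0 ∧ ContDiffOn ℝ ∞ F {v | v ≠ 0} ∧
    ∀ (t : ℝ) (v : ℝ × ℝ), t ≠ 0 → v ≠ 0 → F (t • v) = quasiChar η (μ - 1) t * F v}
  add_mem' := by
    rintro f f' ⟨h1, h2, h3⟩ ⟨h1', h2', h3'⟩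
    refine ⟨by simp [h1, h1'], h2.add h2', fun t v ht hv => ?_⟩
    simp only [Pi.add_apply, h3 t v ht hv, h3' t v ht hv, mul_add]
  zero_mem' := ⟨rfl, contDiffOn_const, fun _ _ _ _ => by simp⟩
  smul_mem' := by
    rintro c f ⟨h1, h2, h3⟩
    refine ⟨by simp [h1], contDiffOn_const.smul h2, fun t v ht hv => ?_⟩
    simp only [Pi.smul_apply, h3 t v ht hv, smul_eq_mul]
    ring

/-- Linear functionals on `W_{-μ,η}^∞`; the continuous ones are the distribution vectors. -/
abbrev SL2Functional (μ : ℂ) (η : ZMod 2) : Type := SL2Smooth (-μ) η →ₗ[ℂ] ℂ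

/-- Membership in `W_{μ,η}^{-∞}`, the dual of `W_{-μ,η}^∞`: continuity with respect to uniform
convergence on compact subsets of `ℝ² - {0}` of the functions and all their derivatives. -/
def IsSL2DistVector {μ : ℂ} {η : ZMod 2} (S : SL2Functional μ η) : Prop :=
  ∃ (K : Set (ℝ × ℝ)) (m : ℕ) (C : ℝ), IsCompact K ∧ K ⊆ {v | v ≠ 0} ∧
    ∀ (F : SL2Smooth (-μ) η) (B : ℝ), 0 ≤ B →
      (∀ i ≤ m, ∀ v ∈ K, ‖iteratedFDeriv ℝ i (F : ℝ × ℝ → ℂ) v‖ ≤ B) → ‖S F‖ ≤ C * B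

lemma act2_ne_zero {A : Matrix (Fin 2) (Fin 2) ℝ} (hA : A.det ≠ 0) {v : ℝ × ℝ} (hv : v ≠ 0) :
    act2 A v ≠ 0 := by
  intro h
  apply hv
  simp only [act2, Prod.mk_eq_zero] at h
  obtain ⟨h1, h2⟩ := h
  rw [Matrix.det_fin_two] at hA
  ext
  · apply (mul_eq_zero.1 (_ : (A 0 0 * A 1 1 - A 0 1 * A 1 0) * v.1 = 0)).resolve_left hA
    linear_combination A 1 1 * h1 - A 0 1 * h2
  · apply (mul_eq_zero.1 (_ : (A 0 0 * A 1 1 - A 0 1 * A 1 0) * v.2 = 0)).resolve_left hA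
    linear_combination A 0 0 * h2 - A 1 0 * h1

/-- The pullback `F ↦ F ∘ A` by an invertible `2 × 2` matrix `A`. For `A ∈ SL(2, ℝ)` it is the
action of `A⁻¹` on `W_{μ,η}^∞`; on functions on `ℝ` it reads
`f ↦ (sgn (c x + d))^η |c x + d|^(μ-1) f((a x + b) / (c x + d))` if `A = (a, b; c, d)`. -/
def SL2Smooth.pullback (μ : ℂ) (η : ZMod 2) (A : Matrix (Fin 2) (Fin 2) ℝ) (hA : A.det ≠ 0) :
    SL2Smooth μ η →ₗ[ℂ] SL2Smooth μ η where
  toFun F := ⟨fun v => F.1 (act2 A v), by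
    obtain ⟨F, h1, h2, h3⟩ := F
    refine ⟨by simpa [act2, ← Prod.zero_eq_mk] using h1, ?_, fun t v ht hv => ?_⟩
    · refine h2.comp (ContDiff.contDiffOn ?_) (fun v hv => act2_ne_zero hA hv)
      unfold act2
      fun_prop
    · rw [← h3 t _ ht (act2_ne_zero hA hv)]
      refine congrArg F (Prod.ext ?_ ?_) <;> simp [act2] <;> ring⟩
  map_add' _ _ := rfl
  map_smul' _ _ := rfl

/-- The action `ψ_{μ,η}` of `SL(2, ℝ)` on `W_{μ,η}^{-∞}`, dual to that on `W_{-μ,η}^∞`: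
`⟨ψ(g) S, F⟩ = ⟨S, ψ(g⁻¹) F⟩`. -/
def psi (μ : ℂ) (η : ZMod 2) (g : SL(2, ℝ)) (S : SL2Functional μ η) : SL2Functional μ η :=
  S ∘ₗ SL2Smooth.pullback (-μ) η (g : Matrix (Fin 2) (Fin 2) ℝ) (by rw [g.2]; exact one_ne_zero)

/-- The reflection `x ↦ -x` on `W_{μ,η}^{-∞}`, that is `σ(x) ↦ σ(-x)`. -/
def reflect (μ : ℂ) (η : ZMod 2) (S : SL2Functional μ η) : SL2Functional μ η :=
  S ∘ₗ SL2Smooth.pullback (-μ) η !![-1, 0; 0, 1] (by simp)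

/-- The matrix `(1, t; 0, 1)`. -/
def unip (t : ℝ) : SL(2, ℝ) := ⟨!![1, t; 0, 1], by simp⟩

/-- The matrix `(0, 1; -1, 0)`. -/
def weyl : SL(2, ℝ) := ⟨!![0, 1; -1, 0], by simp⟩

/-- The matrix `(ā, -1/c; c, 0)`. -/
def cuspMatrix (abar c : ℤ) (hc : c ≠ 0) : SL(2, ℝ) :=
  ⟨!![(abar : ℝ), -(c : ℝ)⁻¹; (c : ℝ), 0], by
    have : (c : ℝ) ≠ 0 := by exact_mod_cast hc
    simp [this]⟩

/-- A function which is smooth on an open set `U` and vanishes near every point of `Ω` outside `U`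
is smooth on `Ω`. -/
lemma contDiffOn_of_vanish {E : Type*} [NormedAddCommGroup E] [NormedSpace ℝ E] {f : E → ℂ}
    {Ω U : Set E} (h1 : ∀ x ∈ U, ContDiffAt ℝ ∞ f x) (h2 : ∀ x ∈ Ω, x ∉ U → f =ᶠ[𝓝 x] 0) :
    ContDiffOn ℝ ∞ f Ω := by
  intro x hx
  by_cases hU : x ∈ U
  · exact (h1 x hU).contDiffWithinAt
  · exact (contDiffAt_const (c := (0 : ℂ)) |>.congr_of_eventuallyEq (h2 x hx hU)).contDiffWithinAt

/-- A test function vanishes outside some ball. -/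
lemma Test.exists_bound {E : Type*} [NormedAddCommGroup E] [NormedSpace ℝ E] (φ : Test E) :
    ∃ R : ℝ, 0 ≤ R ∧ ∀ x, φ x ≠ 0 → ‖x‖ ≤ R := by
  obtain ⟨R, hR⟩ := φ.hasCompactSupport.isCompact.isBounded.exists_norm_le
  refine ⟨max R 0, le_max_right _ _, fun x hx => ?_⟩
  exact (hR x (subset_tsupport _ hx)).trans (le_max_left _ _)

/-- The extension by zero of a test function on `ℝ` to a vector in `W_{μ,η}^∞`, i.e. the unique
`F` with `F(x, 1) = φ(x)` and `F(1, 0) = 0`. -/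
def lineSection (μ : ℂ) (η : ZMod 2) : Test ℝ →ₗ[ℂ] SL2Smooth μ η where
  toFun φ := ⟨fun v => if v.2 = 0 then 0 else quasiChar η (μ - 1) v.2 * φ (v.1 / v.2), by
    refine ⟨by simp, ?_, fun t v ht hv => ?_⟩
    · refine contDiffOn_of_vanish (U := {v | v.2 ≠ 0}) (fun v hv => ?_) (fun v hv hv2 => ?_)
      · have h : ContDiffAt ℝ ∞ (fun v : ℝ × ℝ => quasiChar η (μ - 1) v.2 * φ (v.1 / v.2)) v :=
          ((contDiffAt_quasiChar η _ hv).comp v contDiffAt_snd).mul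
            (φ.contDiff.contDiffAt.comp v (contDiffAt_fst.div contDiffAt_snd hv))
        refine h.congr_of_eventuallyEq ?_
        filter_upwards [continuousAt_snd.eventually_ne hv] with w hw
        simp [hw]
      · obtain ⟨R, hR, hφ⟩ := φ.exists_bound
        simp only [Set.mem_ofPred_eq, ne_eq, not_not] at hv hv2
        have hv1 : v.1 ≠ 0 := fun h => hv (Prod.ext h hv2)
        have hlt : ∀ᶠ w : ℝ × ℝ in 𝓝 v, R * |w.2| < |w.1| := by
          refine ContinuousAt.eventually_lt (by fun_prop) (by fun_prop) ?_
          simpa [hv2] using hv1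
        filter_upwards [hlt] with w hw
        simp only [Pi.zero_apply, ite_eq_left_iff]
        intro hw2
        rw [mul_eq_zero]
        right
        by_contra h
        have := hφ _ h
        rw [Real.norm_eq_abs, abs_div, div_le_iff₀ (abs_pos.2 hw2)] at this
        linarith
    · by_cases h : v.2 = 0
      · simp [h]
      · simp only [Prod.smul_snd, Prod.smul_fst, smul_eq_mul, mul_eq_zero, ht, h, or_self, if_false]
        rw [mul_div_mul_left _ _ ht, quasiChar_mul, mul_assoc]⟩
  map_add' φ φ' := by
    ext v
    by_cases h : v.2 = 0 <;> simp [h, mul_add]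
  map_smul' c φ := by
    ext v
    by_cases h : v.2 = 0
    · simp [h]
    · simp [h]; ring

/-- The restriction to `ℝ` of a distribution vector for `SL(2, ℝ)`. -/
def restrictLine {μ : ℂ} {η : ZMod 2} (S : SL2Functional μ η) : Test ℝ →ₗ[ℂ] ℂ :=
  S ∘ₗ lineSection (-μ) η

/-! ### Coordinates on the open cell and extension of functions to `GL(3, ℝ)` -/

/-- The lower right `2 × 2` minor. -/
def minor (g : Mat3) : ℝ := g 1 1 * g 2 2 - g 1 2 * g 2 1

/-- For `g = n p` with `p` lower triangular and `n` the upper triangular unipotent matrix with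
entries `n₁₂ = x`, `n₂₃ = y`, `n₁₃ = z`, the functions `xCoord`, `yCoord`, `zCoord`, `wCoord` are
`x`, `y`, `z`, `z - x y`. -/
def xCoord (g : Mat3) : ℝ := (g 0 1 * g 2 2 - g 0 2 * g 2 1) / minor g

/-- The coordinate `y`; see `xCoord`. -/
def yCoord (g : Mat3) : ℝ := g 1 2 / g 2 2

/-- The coordinate `z`; see `xCoord`. -/
def zCoord (g : Mat3) : ℝ := g 0 2 / g 2 2

/-- The coordinate `z - x y`; see `xCoord`. -/
def wCoord (g : Mat3) : ℝ := (g 0 2 * g 1 1 - g 0 1 * g 1 2) / minor g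

lemma inducingChar_eq (lam : Fin 3 → ℂ) (del : Fin 3 → ZMod 2) (p : Mat3) (h0 : p 0 0 ≠ 0)
    (h2 : p 2 2 ≠ 0) :
    inducingChar lam del p = quasiChar (del 0) (lam 0 - 1) (p 0 0) *
      quasiChar (del 1) (lam 1) (p 1 1) * quasiChar (del 2) (lam 2 + 1) (p 2 2) := by
  have e0 : quasiChar (del 0) (lam 0 - 1) (p 0 0) =
      quasiChar (del 0) (lam 0) (p 0 0) * ((|p 0 0| : ℝ) : ℂ)⁻¹ := by
    have := quasiChar_add (del 0) 0 (lam 0) (-1) h0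
    rw [add_zero, ← sub_eq_add_neg] at this
    rw [this]
    simp [quasiChar, cpow_neg_one]
  have e2 : quasiChar (del 2) (lam 2 + 1) (p 2 2) =
      quasiChar (del 2) (lam 2) (p 2 2) * ((|p 2 2| : ℝ) : ℂ) := by
    have := quasiChar_add (del 2) 0 (lam 2) 1 h2
    rw [add_zero] at this
    rw [this]
    simp [quasiChar]
  rw [e0, e2, inducingChar, Fin.prod_univ_three, ofReal_div]
  ring

lemma IsLower.det {p : Mat3} (hp : IsLower p) : p.det = p 0 0 * p 1 1 * p 2 2 := by
  rw [Matrix.det_fin_three, hp 0 1 (by decide), hp 0 2 (by decide), hp 1 2 (by decide)]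
  ring

lemma IsLower.mul_entries {p : Mat3} (hp : IsLower p) (g : Mat3) (i : Fin 3) :
    (g * p) i 2 = g i 2 * p 2 2 ∧ (g * p) i 1 = g i 1 * p 1 1 + g i 2 * p 2 1 := by
  simp [Matrix.mul_apply, Fin.sum_univ_three, hp 0 1 (by decide), hp 0 2 (by decide),
    hp 1 2 (by decide)]

lemma IsLower.minor_mul {p : Mat3} (hp : IsLower p) (g : Mat3) :
    minor (g * p) = minor g * (p 1 1 * p 2 2) := by
  simp only [minor, hp.mul_entries]
  ring

lemma IsLower.coord_mul {p : Mat3} (hp : IsLower p) (hd : p.det ≠ 0) (g : Mat3) :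
    xCoord (g * p) = xCoord g ∧ yCoord (g * p) = yCoord g ∧ zCoord (g * p) = zCoord g ∧
      wCoord (g * p) = wCoord g := by
  rw [hp.det] at hd
  have h2 : p 2 2 ≠ 0 := right_ne_zero_of_mul hd
  have h1 : p 1 1 ≠ 0 := right_ne_zero_of_mul (left_ne_zero_of_mul hd)
  refine ⟨?_, ?_, ?_, ?_⟩
  · rw [xCoord, hp.minor_mul, xCoord, ← mul_div_mul_right (g 0 1 * g 2 2 - g 0 2 * g 2 1)
      (minor g) (mul_ne_zero h1 h2)]
    simp only [hp.mul_entries]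
    congr 1
    ring
  · simp only [yCoord, hp.mul_entries, mul_div_mul_right _ _ h2]
  · simp only [zCoord, hp.mul_entries, mul_div_mul_right _ _ h2]
  · rw [wCoord, hp.minor_mul, wCoord, ← mul_div_mul_right (g 0 2 * g 1 1 - g 0 1 * g 1 2)
      (minor g) (mul_ne_zero h1 h2)]
    simp only [hp.mul_entries]
    congr 1
    ring

/-- The inducing character at the diagonal matrix with entries `a`, `b`, `c`. -/
def diagChar (lam : Fin 3 → ℂ) (del : Fin 3 → ZMod 2) (a b c : ℝ) : ℂ :=
  inducingChar lam del (Matrix.diagonal ![a, b, c])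

lemma diagChar_eq (lam : Fin 3 → ℂ) (del : Fin 3 → ZMod 2) {a b c : ℝ} (ha : a ≠ 0) (hc : c ≠ 0) :
    diagChar lam del a b c = quasiChar (del 0) (lam 0 - 1) a *
      quasiChar (del 1) (lam 1) b * quasiChar (del 2) (lam 2 + 1) c := by
  rw [diagChar, inducingChar_eq] <;> simp [ha, hc]

lemma diagChar_ne_zero (lam : Fin 3 → ℂ) (del : Fin 3 → ZMod 2) {a b c : ℝ} (ha : a ≠ 0)
    (hb : b ≠ 0) (hc : c ≠ 0) : diagChar lam del a b c ≠ 0 := by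
  rw [diagChar_eq _ _ ha hc]
  exact mul_ne_zero (mul_ne_zero (quasiChar_ne_zero _ _ ha) (quasiChar_ne_zero _ _ hb))
    (quasiChar_ne_zero _ _ hc)

lemma contDiffAt_diagChar_inv (lam : Fin 3 → ℂ) (del : Fin 3 → ZMod 2) {a b c : Mat3 → ℝ} {g : Mat3}
    (ha : ContDiffAt ℝ ∞ a g) (hb : ContDiffAt ℝ ∞ b g) (hc : ContDiffAt ℝ ∞ c g)
    (ha0 : a g ≠ 0) (hb0 : b g ≠ 0) (hc0 : c g ≠ 0) :
    ContDiffAt ℝ ∞ (fun g => (diagChar lam del (a g) (b g) (c g))⁻¹) g := by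
  have h : ContDiffAt ℝ ∞ (fun g => quasiChar (del 0) (lam 0 - 1) (a g) *
      quasiChar (del 1) (lam 1) (b g) * quasiChar (del 2) (lam 2 + 1) (c g)) g :=
    (((contDiffAt_quasiChar _ _ ha0).comp g ha).mul ((contDiffAt_quasiChar _ _ hb0).comp g hb)).mul
      ((contDiffAt_quasiChar _ _ hc0).comp g hc)
  have h' := h.inv (by
    rw [← diagChar_eq _ _ ha0 hc0]
    exact diagChar_ne_zero _ _ ha0 hb0 hc0)
  refine h'.congr_of_eventuallyEq ?_
  filter_upwards [ha.continuousAt.eventually_ne ha0, hc.continuousAt.eventually_ne hc0] with w h1 h2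
  rw [diagChar_eq _ _ h1 h2, Pi.inv_apply]

lemma contDiff_minor : ContDiff ℝ ∞ minor := by
  unfold minor
  exact ((contDiff_entry 1 1).mul (contDiff_entry 2 2)).sub
    ((contDiff_entry 1 2).mul (contDiff_entry 2 1))

lemma contDiff_det3 : ContDiff ℝ ∞ (fun g : Mat3 => g.det) := by
  have h := contDiff_entry
  simp only [Matrix.det_fin_three]
  exact (((((((h 0 0).mul (h 1 1)).mul (h 2 2)).sub (((h 0 0).mul (h 1 2)).mul (h 2 1))).sub
    (((h 0 1).mul (h 1 0)).mul (h 2 2))).add (((h 0 1).mul (h 1 2)).mul (h 2 0))).add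
    (((h 0 2).mul (h 1 0)).mul (h 2 1))).sub (((h 0 2).mul (h 1 1)).mul (h 2 0))

lemma contDiffAt_xCoord {g : Mat3} (hg : minor g ≠ 0) : ContDiffAt ℝ ∞ xCoord g :=
  ContDiffAt.div ((((contDiff_entry 0 1).mul (contDiff_entry 2 2)).sub
    ((contDiff_entry 0 2).mul (contDiff_entry 2 1))).contDiffAt) contDiff_minor.contDiffAt hg

lemma contDiffAt_wCoord {g : Mat3} (hg : minor g ≠ 0) : ContDiffAt ℝ ∞ wCoord g :=
  ContDiffAt.div ((((contDiff_entry 0 2).mul (contDiff_entry 1 1)).sub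
    ((contDiff_entry 0 1).mul (contDiff_entry 1 2))).contDiffAt) contDiff_minor.contDiffAt hg

lemma contDiffAt_yCoord {g : Mat3} (hg : g 2 2 ≠ 0) : ContDiffAt ℝ ∞ yCoord g :=
  ContDiffAt.div (contDiff_entry 1 2).contDiffAt (contDiff_entry 2 2).contDiffAt hg

lemma contDiffAt_zCoord {g : Mat3} (hg : g 2 2 ≠ 0) : ContDiffAt ℝ ∞ zCoord g :=
  ContDiffAt.div (contDiff_entry 0 2).contDiffAt (contDiff_entry 2 2).contDiffAt hg

/-- Near a matrix in `GL(3, ℝ)` with vanishing lower right entry, `yCoord` or `zCoord` is large. -/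
lemma large_yz {g : Mat3} (hg : g.det ≠ 0) (h2 : g 2 2 = 0) (R : ℝ) :
    ∀ᶠ h : Mat3 in 𝓝 g, ¬ (h 2 2 ≠ 0 ∧ |yCoord h| ≤ R ∧ |zCoord h| ≤ R) := by
  have hc : ∀ i j, Continuous (fun h : Mat3 => h i j) := fun i j => (contDiff_entry i j).continuous
  have hlt : ∀ᶠ h : Mat3 in 𝓝 g, 2 * R * |h 2 2| < |h 1 2| + |h 0 2| := by
    refine ContinuousAt.eventually_lt
      ((continuous_const.mul (hc 2 2).abs).continuousAt)
      (((hc 1 2).abs.add (hc 0 2).abs).continuousAt) ?_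
    rw [h2, abs_zero, mul_zero]
    by_contra hcon
    have h3 : g 1 2 = 0 := abs_eq_zero.1 (by linarith [abs_nonneg (g 1 2), abs_nonneg (g 0 2)])
    have h4 : g 0 2 = 0 := abs_eq_zero.1 (by linarith [abs_nonneg (g 1 2), abs_nonneg (g 0 2)])
    apply hg
    rw [Matrix.det_fin_three, h2, h3, h4]
    ring
  filter_upwards [hlt] with h hh
  rintro ⟨h0, hy, hz⟩
  rw [yCoord, abs_div, div_le_iff₀ (abs_pos.2 h0)] at hy
  rw [zCoord, abs_div, div_le_iff₀ (abs_pos.2 h0)] at hz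
  linarith

/-- Near a matrix in `GL(3, ℝ)` with vanishing lower right minor, `xCoord` or `wCoord` is large. -/
lemma large_xw {g : Mat3} (hg : g.det ≠ 0) (h2 : minor g = 0) (R : ℝ) :
    ∀ᶠ h : Mat3 in 𝓝 g, ¬ (minor h ≠ 0 ∧ |xCoord h| ≤ R ∧ |wCoord h| ≤ R) := by
  have hc : ∀ i j, Continuous (fun h : Mat3 => h i j) := fun i j => (contDiff_entry i j).continuous
  have hlt : ∀ᶠ h : Mat3 in 𝓝 g, 2 * R * |minor h| <
      |h 0 1 * h 2 2 - h 0 2 * h 2 1| + |h 0 2 * h 1 1 - h 0 1 * h 1 2| := by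
    refine ContinuousAt.eventually_lt
      ((continuous_const.mul contDiff_minor.continuous.abs).continuousAt)
      (((((hc 0 1).mul (hc 2 2)).sub ((hc 0 2).mul (hc 2 1))).abs.add
        (((hc 0 2).mul (hc 1 1)).sub ((hc 0 1).mul (hc 1 2))).abs).continuousAt) ?_
    rw [h2, abs_zero, mul_zero]
    by_contra hcon
    have n1 := abs_nonneg (g 0 1 * g 2 2 - g 0 2 * g 2 1)
    have n2 := abs_nonneg (g 0 2 * g 1 1 - g 0 1 * g 1 2)
    have h3 : g 0 1 * g 2 2 - g 0 2 * g 2 1 = 0 := abs_eq_zero.1 (by linarith)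
    have h4 : g 0 2 * g 1 1 - g 0 1 * g 1 2 = 0 := abs_eq_zero.1 (by linarith)
    apply hg
    rw [minor] at h2
    rw [Matrix.det_fin_three]
    linear_combination g 0 0 * h2 - g 1 0 * h3 - g 2 0 * h4
  filter_upwards [hlt] with h hh
  rintro ⟨h0, hx, hw⟩
  rw [xCoord, abs_div, div_le_iff₀ (abs_pos.2 h0)] at hx
  rw [wCoord, abs_div, div_le_iff₀ (abs_pos.2 h0)] at hw
  linarith

/-- The extension by zero of a test function on `N ≅ ℝ³` to a vector in `V_{λ,δ}^∞`: the function
`f` with `f(n p) = ω_{λ,δ}(p⁻¹) ψ(n)` for `n ∈ N`, `p ∈ P`, which vanishes outside `N P`. -/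
def extendN (lam : Fin 3 → ℂ) (del : Fin 3 → ZMod 2) :
    Test (ℝ × ℝ × ℝ) →ₗ[ℂ] SmoothVector lam del where
  toFun ψ := ⟨fun g => if g.det ≠ 0 ∧ g 2 2 ≠ 0 ∧ minor g ≠ 0 then
      (diagChar lam del (g.det / minor g) (minor g / g 2 2) (g 2 2))⁻¹ *
        ψ (xCoord g, yCoord g, zCoord g) else 0, by
    refine ⟨fun g hg => by simp [hg], ?_, fun g p hg hd hp => ?_⟩
    · refine contDiffOn_of_vanish (U := {g | g.det ≠ 0 ∧ g 2 2 ≠ 0 ∧ minor g ≠ 0})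
        (fun g hg => ?_) (fun g hg hg2 => ?_)
      · obtain ⟨hd, h2, hm⟩ := hg
        have h : ContDiffAt ℝ ∞ (fun g : Mat3 =>
            (diagChar lam del (g.det / minor g) (minor g / g 2 2) (g 2 2))⁻¹ *
              ψ (xCoord g, yCoord g, zCoord g)) g := by
          refine ContDiffAt.mul (contDiffAt_diagChar_inv _ _
            (contDiff_det3.contDiffAt.div contDiff_minor.contDiffAt hm)
            (contDiff_minor.contDiffAt.div (contDiff_entry 2 2).contDiffAt h2)
            (contDiff_entry 2 2).contDiffAt (div_ne_zero hd hm) (div_ne_zero hm h2) h2) ?_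
          exact ψ.contDiff.contDiffAt.comp g ((contDiffAt_xCoord hm).prodMk
            ((contDiffAt_yCoord h2).prodMk (contDiffAt_zCoord h2)))
        refine h.congr_of_eventuallyEq ?_
        filter_upwards [contDiff_det3.continuous.continuousAt.eventually_ne hd,
          (contDiff_entry 2 2).continuous.continuousAt.eventually_ne h2,
          contDiff_minor.continuous.continuousAt.eventually_ne hm] with w w1 w2 w3
        simp [w1, w2, w3]
      · obtain ⟨R, hR, hψ⟩ := ψ.exists_bound
        have hbd : ∀ h : Mat3, h 2 2 ≠ 0 → minor h ≠ 0 → ψ (xCoord h, yCoord h, zCoord h) ≠ 0 →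
            |xCoord h| ≤ R ∧ |yCoord h| ≤ R ∧ |zCoord h| ≤ R ∧ |wCoord h| ≤ R + R * R := by
          intro h h2 hm hne
          have := hψ _ hne
          simp only [Prod.norm_def, sup_le_iff, Real.norm_eq_abs] at this
          obtain ⟨a1, a2, a3⟩ := this
          have hw : wCoord h = zCoord h - xCoord h * yCoord h := by
            rw [wCoord, xCoord, yCoord, zCoord]
            field_simp
            rw [minor]
            ring
          refine ⟨a1, a2, a3, ?_⟩
          rw [hw]
          refine (abs_sub _ _).trans (add_le_add a3 ?_)
          rw [abs_mul]
          exact mul_le_mul a1 a2 (abs_nonneg _) hR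
        by_cases h2 : g 2 2 = 0
        · filter_upwards [large_yz hg h2 R] with h hh
          simp only [Pi.zero_apply, ite_eq_right_iff]
          rintro ⟨-, k2, k3⟩
          by_contra hne
          obtain ⟨-, b2, b3, -⟩ := hbd h k2 k3 (right_ne_zero_of_mul hne)
          exact hh ⟨k2, b2, b3⟩
        · have hm : minor g = 0 := by
            by_contra hm
            exact hg2 ⟨hg, h2, hm⟩
          filter_upwards [large_xw hg hm (R + R * R)] with h hh
          simp only [Pi.zero_apply, ite_eq_right_iff]
          rintro ⟨-, k2, k3⟩
          by_contra hne
          obtain ⟨b1, -, -, b4⟩ := hbd h k2 k3 (right_ne_zero_of_mul hne)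
          exact hh ⟨k3, by nlinarith, b4⟩
    · have hd' := hd
      rw [hp.det] at hd'
      have p2 : p 2 2 ≠ 0 := right_ne_zero_of_mul hd'
      have p1 : p 1 1 ≠ 0 := right_ne_zero_of_mul (left_ne_zero_of_mul hd')
      have p0 : p 0 0 ≠ 0 := left_ne_zero_of_mul (left_ne_zero_of_mul hd')
      obtain ⟨cx, cy, cz, -⟩ := hp.coord_mul hd g
      have e22 := (hp.mul_entries g 2).1
      simp only [cx, cy, cz, hp.minor_mul, e22, Matrix.det_mul]
      by_cases hc : g 2 2 ≠ 0 ∧ minor g ≠ 0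
      · obtain ⟨h2, hm⟩ := hc
        have key : (diagChar lam del (g.det * p.det / (minor g * (p 1 1 * p 2 2)))
              (minor g * (p 1 1 * p 2 2) / (g 2 2 * p 2 2)) (g 2 2 * p 2 2))⁻¹ =
            (inducingChar lam del p)⁻¹ *
              (diagChar lam del (g.det / minor g) (minor g / g 2 2) (g 2 2))⁻¹ := by
          rw [← mul_inv, diagChar_eq _ _ (div_ne_zero (mul_ne_zero hg hd)
              (mul_ne_zero hm (mul_ne_zero p1 p2))) (mul_ne_zero h2 p2),
            diagChar_eq _ _ (div_ne_zero hg hm) h2, inducingChar_eq _ _ _ p0 p2,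
            show g.det * p.det / (minor g * (p 1 1 * p 2 2)) = p 0 0 * (g.det / minor g) by
              rw [hp.det]; field_simp,
            show minor g * (p 1 1 * p 2 2) / (g 2 2 * p 2 2) = p 1 1 * (minor g / g 2 2) by
              field_simp]
          simp only [quasiChar_mul]
          ring
        rw [if_pos ⟨mul_ne_zero hg hd, mul_ne_zero h2 p2, mul_ne_zero hm (mul_ne_zero p1 p2)⟩,
          if_pos ⟨hg, h2, hm⟩, key, mul_assoc]
      · rw [if_neg, if_neg, mul_zero]
        · rintro ⟨-, h⟩
          exact hc h
        · rintro ⟨-, h2, hm⟩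
          exact hc ⟨left_ne_zero_of_mul h2, left_ne_zero_of_mul hm⟩⟩
  map_add' φ φ' := by
    ext g
    by_cases h : g.det ≠ 0 ∧ g 2 2 ≠ 0 ∧ minor g ≠ 0
    · simp [h, mul_add]
    · simp only [if_neg h, Submodule.coe_add, Pi.add_apply, add_zero]
  map_smul' c φ := by
    ext g
    by_cases h : g.det ≠ 0 ∧ g 2 2 ≠ 0 ∧ minor g ≠ 0
    · simp [h]; ring
    · simp only [if_neg h, Submodule.coe_smul, Pi.smul_apply, smul_zero]

/-- The second column of `g`, corrected by a multiple of the third so that its last entry is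
`0`. -/
def colUpper (g : Mat3) : ℝ × ℝ :=
  (g 0 1 - g 0 2 * (g 2 1 / g 2 2), g 1 1 - g 1 2 * (g 2 1 / g 2 2))

/-- The lower two entries of the third column of `g`. -/
def colLower (g : Mat3) : ℝ × ℝ := (g 1 2, g 2 2)

lemma colUpper_ne_zero {g : Mat3} (hg : g.det ≠ 0) (h2 : g 2 2 ≠ 0) : colUpper g ≠ 0 := by
  intro h
  simp only [colUpper, Prod.mk_eq_zero] at h
  obtain ⟨h3, h4⟩ := h
  apply hg
  have e3 : g 0 1 = g 0 2 * (g 2 1 / g 2 2) := by linarith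
  have e4 : g 1 1 = g 1 2 * (g 2 1 / g 2 2) := by linarith
  rw [Matrix.det_fin_three, e3, e4]
  field_simp
  ring

lemma colLower_ne_zero {g : Mat3} (hm : minor g ≠ 0) : colLower g ≠ 0 := by
  intro h
  simp only [colLower, Prod.mk_eq_zero] at h
  apply hm
  rw [minor, h.1, h.2]
  ring

/-- Parameters `(λ, δ)` of a principal series representation of `GL(3, ℝ)`, with
`λ₁ + λ₂ + λ₃ = 0` and `δ₁ + δ₂ + δ₃ = 0`. -/
structure Params where
  lam : Fin 3 → ℂ
  del : Fin 3 → ZMod 2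
  sum_lam : ∑ j, lam j = 0
  sum_del : ∑ j, del j = 0

/-- `μ = λ₁ - λ₂` -/
def Params.mu12 (P : Params) : ℂ := P.lam 0 - P.lam 1

/-- `μ = λ₂ - λ₃` -/
def Params.mu23 (P : Params) : ℂ := P.lam 1 - P.lam 2

/-- The space `V_{λ,δ}^{-∞}`. -/
abbrev Params.Dist (P : Params) : Type := DistVector P.lam P.del

lemma Params.del01 (P : Params) : P.del 0 + P.del 1 = P.del 2 := by
  have h := P.sum_del
  rw [Fin.sum_univ_three] at h
  have key : ∀ a b c : ZMod 2, a + b + c = 0 → a + b = c := by decide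
  exact key _ _ _ h

lemma Params.del12 (P : Params) : P.del 1 + P.del 2 = P.del 0 := by
  have h := P.sum_del
  rw [Fin.sum_univ_three] at h
  have key : ∀ a b c : ZMod 2, a + b + c = 0 → b + c = a := by decide
  exact key _ _ _ h

/-- Let `F ∈ W_{-μ,δ₃}^∞`, `μ = λ₁ - λ₂`, let `Φ` be a test function on `ℝ²`, let `S` be the upper
left copy of `SL(2, ℝ)` in `GL(3, ℝ)` and `N_{y,z}` the group of the matrices in `N` with `x = 0`.
This is the vector `f ∈ V_{-λ,δ}^∞` with
`f(n s p) = ω_{-λ,δ}(p⁻¹) Φ(y, z) F(s e₂)` for `n = n(0, y, z)`, `s ∈ S`, `p ∈ P`,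
which vanishes outside the open set `N_{y,z} S P = {g₃₃ ≠ 0}`. -/
def extendUpper (P : Params) (Φ : Test (ℝ × ℝ)) :
    SL2Smooth (-P.mu12) (P.del 2) →ₗ[ℂ] SmoothVector (-P.lam) P.del where
  toFun F := ⟨fun g => if g.det ≠ 0 ∧ g 2 2 ≠ 0 then
      (diagChar (-P.lam) P.del (g.det / g 2 2) 1 (g 2 2))⁻¹ *
        (Φ (yCoord g, zCoord g) * F.1 (colUpper g)) else 0, by
    obtain ⟨F, -, hF, hFt⟩ := F
    refine ⟨fun g hg => by simp [hg], ?_, fun g p hg hd hp => ?_⟩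
    · refine contDiffOn_of_vanish (U := {g | g.det ≠ 0 ∧ g 2 2 ≠ 0})
        (fun g hg => ?_) (fun g hg hg2 => ?_)
      · obtain ⟨hd, h2⟩ := hg
        have hent := fun i j => (contDiff_entry i j).contDiffAt (x := g)
        have hcol : ContDiffAt ℝ ∞ colUpper g :=
          ((hent 0 1).sub ((hent 0 2).mul ((hent 2 1).div (hent 2 2) h2))).prodMk
            ((hent 1 1).sub ((hent 1 2).mul ((hent 2 1).div (hent 2 2) h2)))
        have hFc : ContDiffAt ℝ ∞ F (colUpper g) :=
          hF.contDiffAt (isOpen_ne.mem_nhds (colUpper_ne_zero hd h2))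
        have h : ContDiffAt ℝ ∞ (fun g : Mat3 =>
            (diagChar (-P.lam) P.del (g.det / g 2 2) 1 (g 2 2))⁻¹ *
              (Φ (yCoord g, zCoord g) * F (colUpper g))) g := by
          refine ContDiffAt.mul (contDiffAt_diagChar_inv _ _
            (contDiff_det3.contDiffAt.div (hent 2 2) h2) contDiffAt_const (hent 2 2)
            (div_ne_zero hd h2) one_ne_zero h2) (ContDiffAt.mul ?_ (hFc.comp g hcol))
          exact Φ.contDiff.contDiffAt.comp g ((contDiffAt_yCoord h2).prodMk (contDiffAt_zCoord h2))
        refine h.congr_of_eventuallyEq ?_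
        filter_upwards [contDiff_det3.continuous.continuousAt.eventually_ne hd,
          (contDiff_entry 2 2).continuous.continuousAt.eventually_ne h2] with w w1 w2
        simp [w1, w2]
      · obtain ⟨R, hR, hΦ⟩ := Φ.exists_bound
        have h2 : g 2 2 = 0 := by
          by_contra h2
          exact hg2 ⟨hg, h2⟩
        filter_upwards [large_yz hg h2 R] with h hh
        simp only [Pi.zero_apply, ite_eq_right_iff]
        rintro ⟨-, k2⟩
        by_contra hne
        have := hΦ _ (left_ne_zero_of_mul (right_ne_zero_of_mul hne))
        simp only [Prod.norm_def, sup_le_iff, Real.norm_eq_abs] at this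
        exact hh ⟨k2, this⟩
    · have hd' := hd
      rw [hp.det] at hd'
      have p2 : p 2 2 ≠ 0 := right_ne_zero_of_mul hd'
      have p1 : p 1 1 ≠ 0 := right_ne_zero_of_mul (left_ne_zero_of_mul hd')
      have p0 : p 0 0 ≠ 0 := left_ne_zero_of_mul (left_ne_zero_of_mul hd')
      obtain ⟨-, cy, cz, -⟩ := hp.coord_mul hd g
      have e22 := (hp.mul_entries g 2).1
      simp only [cy, cz, e22, Matrix.det_mul]
      by_cases h2 : g 2 2 ≠ 0
      · have hcol : colUpper (g * p) = p 1 1 • colUpper g := by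
          ext
          · simp only [colUpper, hp.mul_entries, Prod.smul_fst, smul_eq_mul]
            field_simp
            ring
          · simp only [colUpper, hp.mul_entries, Prod.smul_snd, smul_eq_mul]
            field_simp
            ring
        have key : (diagChar (-P.lam) P.del (g.det * p.det / (g 2 2 * p 2 2)) 1
              (g 2 2 * p 2 2))⁻¹ * quasiChar (P.del 2) (-P.mu12 - 1) (p 1 1) =
            (inducingChar (-P.lam) P.del p)⁻¹ *
              (diagChar (-P.lam) P.del (g.det / g 2 2) 1 (g 2 2))⁻¹ := by
          have hsplit : quasiChar (P.del 0) ((-P.lam) 0 - 1) (p 1 1) =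
              quasiChar (P.del 2) (-P.mu12 - 1) (p 1 1) *
                quasiChar (P.del 1) ((-P.lam) 1) (p 1 1) := by
            rw [← quasiChar_add _ _ _ _ p1, Params.mu12]
            have : ∀ a b c : ZMod 2, a + b = c → a = c + b := by decide
            rw [← this _ _ _ P.del01]
            congr 1
            simp only [Pi.neg_apply]
            ring
          rw [← mul_inv, diagChar_eq _ _ (div_ne_zero (mul_ne_zero hg hd) (mul_ne_zero h2 p2))
              (mul_ne_zero h2 p2),
            diagChar_eq _ _ (div_ne_zero hg h2) h2, inducingChar_eq _ _ _ p0 p2,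
            show g.det * p.det / (g 2 2 * p 2 2) = p 0 0 * p 1 1 * (g.det / g 2 2) by
              rw [hp.det]; field_simp]
          simp only [quasiChar_mul, quasiChar_one]
          rw [hsplit]
          have n2 := quasiChar_ne_zero (P.del 2) (-P.mu12 - 1) p1
          simp only [mul_inv]
          field_simp
        rw [if_pos ⟨mul_ne_zero hg hd, mul_ne_zero h2 p2⟩, if_pos ⟨hg, h2⟩, hcol,
          hFt _ _ p1 (colUpper_ne_zero hg h2)]
        linear_combination (Φ (yCoord g, zCoord g) * F (colUpper g)) * key
      · rw [if_neg, if_neg, mul_zero]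
        · rintro ⟨-, h⟩
          exact h2 h
        · rintro ⟨-, h⟩
          exact h2 (left_ne_zero_of_mul h)⟩
  map_add' F F' := by
    ext g
    by_cases h : g.det ≠ 0 ∧ g 2 2 ≠ 0
    · simp [h, mul_add]
    · simp only [if_neg h, Submodule.coe_add, Pi.add_apply, add_zero]
  map_smul' c F := by
    ext g
    by_cases h : g.det ≠ 0 ∧ g 2 2 ≠ 0
    · simp [h]; ring
    · simp only [if_neg h, Submodule.coe_smul, Pi.smul_apply, smul_zero]

/-- Let `F ∈ W_{-μ,δ₁}^∞`, `μ = λ₂ - λ₃`, let `Φ` be a test function on `ℝ²`, let `S'` be the lower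
right copy of `SL(2, ℝ)` in `GL(3, ℝ)` and `N_{x,z}` the group of the matrices in `N` with `y = 0`.
This is the vector `f ∈ V_{-λ,δ}^∞` with
`f(n s p) = ω_{-λ,δ}(p⁻¹) Φ(x, w) F(s e₂)` for `n = n(x, 0, w)`, `s ∈ S'`, `p ∈ P`,
which vanishes outside the open set `N_{x,z} S' P = {minor ≠ 0}`. Note that
`n(x, y, z) = n(x, 0, z - x y) n(0, y, 0)`. -/
def extendLower (P : Params) (Φ : Test (ℝ × ℝ)) :
    SL2Smooth (-P.mu23) (P.del 0) →ₗ[ℂ] SmoothVector (-P.lam) P.del where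
  toFun F := ⟨fun g => if g.det ≠ 0 ∧ minor g ≠ 0 then
      (diagChar (-P.lam) P.del (g.det / minor g) (minor g) 1)⁻¹ *
        (Φ (xCoord g, wCoord g) * F.1 (colLower g)) else 0, by
    obtain ⟨F, -, hF, hFt⟩ := F
    refine ⟨fun g hg => by simp [hg], ?_, fun g p hg hd hp => ?_⟩
    · refine contDiffOn_of_vanish (U := {g | g.det ≠ 0 ∧ minor g ≠ 0})
        (fun g hg => ?_) (fun g hg hg2 => ?_)
      · obtain ⟨hd, hm⟩ := hg
        have hent := fun i j => (contDiff_entry i j).contDiffAt (x := g)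
        have hcol : ContDiffAt ℝ ∞ colLower g := (hent 1 2).prodMk (hent 2 2)
        have hFc : ContDiffAt ℝ ∞ F (colLower g) :=
          hF.contDiffAt (isOpen_ne.mem_nhds (colLower_ne_zero hm))
        have h : ContDiffAt ℝ ∞ (fun g : Mat3 =>
            (diagChar (-P.lam) P.del (g.det / minor g) (minor g) 1)⁻¹ *
              (Φ (xCoord g, wCoord g) * F (colLower g))) g := by
          refine ContDiffAt.mul (contDiffAt_diagChar_inv _ _
            (contDiff_det3.contDiffAt.div contDiff_minor.contDiffAt hm) contDiff_minor.contDiffAt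
            contDiffAt_const (div_ne_zero hd hm) hm one_ne_zero)
            (ContDiffAt.mul ?_ (hFc.comp g hcol))
          exact Φ.contDiff.contDiffAt.comp g ((contDiffAt_xCoord hm).prodMk (contDiffAt_wCoord hm))
        refine h.congr_of_eventuallyEq ?_
        filter_upwards [contDiff_det3.continuous.continuousAt.eventually_ne hd,
          contDiff_minor.continuous.continuousAt.eventually_ne hm] with w w1 w2
        simp [w1, w2]
      · obtain ⟨R, hR, hΦ⟩ := Φ.exists_bound
        have hm : minor g = 0 := by
          by_contra hm
          exact hg2 ⟨hg, hm⟩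
        filter_upwards [large_xw hg hm R] with h hh
        simp only [Pi.zero_apply, ite_eq_right_iff]
        rintro ⟨-, k2⟩
        by_contra hne
        have := hΦ _ (left_ne_zero_of_mul (right_ne_zero_of_mul hne))
        simp only [Prod.norm_def, sup_le_iff, Real.norm_eq_abs] at this
        exact hh ⟨k2, this⟩
    · have hd' := hd
      rw [hp.det] at hd'
      have p2 : p 2 2 ≠ 0 := right_ne_zero_of_mul hd'
      have p1 : p 1 1 ≠ 0 := right_ne_zero_of_mul (left_ne_zero_of_mul hd')
      have p0 : p 0 0 ≠ 0 := left_ne_zero_of_mul (left_ne_zero_of_mul hd')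
      obtain ⟨cx, -, -, cw⟩ := hp.coord_mul hd g
      have hcol : colLower (g * p) = p 2 2 • colLower g := by
        ext
        · simp only [colLower, hp.mul_entries, Prod.smul_fst, smul_eq_mul]
          ring
        · simp only [colLower, hp.mul_entries, Prod.smul_snd, smul_eq_mul]
          ring
      simp only [cx, cw, hp.minor_mul, hcol, Matrix.det_mul]
      by_cases hm : minor g ≠ 0
      · have key : (diagChar (-P.lam) P.del (g.det * p.det / (minor g * (p 1 1 * p 2 2)))
              (minor g * (p 1 1 * p 2 2)) 1)⁻¹ * quasiChar (P.del 0) (-P.mu23 - 1) (p 2 2) =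
            (inducingChar (-P.lam) P.del p)⁻¹ *
              (diagChar (-P.lam) P.del (g.det / minor g) (minor g) 1)⁻¹ := by
          have hsplit : quasiChar (P.del 1) ((-P.lam) 1) (p 2 2) =
              quasiChar (P.del 0) (-P.mu23 - 1) (p 2 2) *
                quasiChar (P.del 2) ((-P.lam) 2 + 1) (p 2 2) := by
            rw [← quasiChar_add _ _ _ _ p2, Params.mu23]
            have : ∀ a b c : ZMod 2, a + b = c → a = c + b := by decide
            rw [← this _ _ _ P.del12]
            congr 1
            simp only [Pi.neg_apply]
            ring
          rw [← mul_inv, diagChar_eq _ _ (div_ne_zero (mul_ne_zero hg hd)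
              (mul_ne_zero hm (mul_ne_zero p1 p2))) one_ne_zero,
            diagChar_eq _ _ (div_ne_zero hg hm) one_ne_zero, inducingChar_eq _ _ _ p0 p2,
            show g.det * p.det / (minor g * (p 1 1 * p 2 2)) = p 0 0 * (g.det / minor g) by
              rw [hp.det]; field_simp]
          simp only [quasiChar_mul, quasiChar_one]
          rw [hsplit]
          have n2 := quasiChar_ne_zero (P.del 0) (-P.mu23 - 1) p2
          simp only [mul_inv]
          field_simp
        rw [if_pos ⟨mul_ne_zero hg hd, mul_ne_zero hm (mul_ne_zero p1 p2)⟩, if_pos ⟨hg, hm⟩,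
          hFt _ _ p2 (colLower_ne_zero hm)]
        linear_combination (Φ (xCoord g, wCoord g) * F (colLower g)) * key
      · rw [if_neg, if_neg, mul_zero]
        · rintro ⟨-, h⟩
          exact hm h
        · rintro ⟨-, h⟩
          exact hm (left_ne_zero_of_mul h)⟩
  map_add' F F' := by
    ext g
    by_cases h : g.det ≠ 0 ∧ minor g ≠ 0
    · simp [h, mul_add]
    · simp only [if_neg h, Submodule.coe_add, Pi.add_apply, add_zero]
  map_smul' c F := by
    ext g
    by_cases h : g.det ≠ 0 ∧ minor g ≠ 0
    · simp [h]; ring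
    · simp only [if_neg h, Submodule.coe_smul, Pi.smul_apply, smul_zero]

/-! ### Fourier components

A `GL(3, ℤ)`-invariant `τ` restricts to a distribution `τ(x, y, z)` on `N ≅ ℝ³`, invariant under
left translation by the integral points of `N`. It is periodic in `y` and in `z`; with
`w = z - x y` in place of `z` as a coordinate it is periodic in `x` and in `w`. Its abelian
Fourier coefficients are
`c_{r,s} = ∫ τ(x, y, z) e(-(r x + s y))`, taken over the quotient of `N` by its integral points, and
its non-abelian components `σ_{n,k}`, `ρ_{n,k}` for `n ≠ 0` are given as follows:
`σ_{n,k}(x + k/n)` is the coefficient of `e(n z + k y)` in the Fourier series of `τ` in `(y, z)`, and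
`ρ_{n,k}(k/n - y)` is the coefficient of `e(n w + k x)` in the Fourier series of `τ` in `(x, w)`.
In other words
`τ = ∑_{r,s} c_{r,s} e(r x + s y) + ∑_{n ≠ 0} ∑_k e(n z + k y) σ_{n,k}(x + k/n)`
` = ∑_{r,s} c_{r,s} e(r x + s y) + ∑_{n ≠ 0} ∑_k e(n (z - x y) + k x) ρ_{n,k}(k/n - y)`,
with `k` running over all integers; `σ_{n,k}` and `ρ_{n,k}` depend only on `k` modulo `n`. -/

/-- The restriction of a distribution vector to `N ≅ ℝ³`, with coordinates `(x, y, z)`. -/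
def restrictN {P : Params} (τ : P.Dist) : Test (ℝ × ℝ × ℝ) →ₗ[ℂ] ℂ :=
  τ.toLin ∘ₗ extendN (-P.lam) P.del

/-- The coordinate change `(x, y, z) ↦ (y, x, z - x y)`. -/
def coordChange : (ℝ × ℝ × ℝ) ≃ₜ (ℝ × ℝ × ℝ) where
  toFun p := (p.2.1, p.1, p.2.2 - p.1 * p.2.1)
  invFun p := (p.2.1, p.1, p.2.2 + p.2.1 * p.1)
  left_inv p := by simp
  right_inv p := by simp
  continuous_toFun := by fun_prop
  continuous_invFun := by fun_prop

/-- The test function `χ(x) χ(y) χ(z) e(-(r x + s y))`. -/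
def abelianTest (r s : ℤ) : Test (ℝ × ℝ × ℝ) :=
  Test.tensor (cutoff.mulSmooth (fun x => e (-(r * x))) (contDiff_e (by fun_prop))) (torusTest s 0)

/-- The test function `φ(x + k/n) χ(y) χ(z) e(-(k y + n z))`. -/
def sigmaTest (n k : ℤ) : Test ℝ →ₗ[ℂ] Test (ℝ × ℝ × ℝ) where
  toFun φ := Test.tensor
    (φ.compHomeo (Homeomorph.addRight ((k : ℝ) / n)) (contDiff_id.add contDiff_const))
    (torusTest k n)
  map_add' _ _ := TestFunction.ext fun _ => add_mul _ _ _
  map_smul' _ _ := TestFunction.ext fun _ => mul_assoc _ _ _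

/-- The test function `φ(k/n - y) χ(x) χ(w) e(-(k x + n w))`, where `w = z - x y`. -/
def rhoTest (n k : ℤ) : Test ℝ →ₗ[ℂ] Test (ℝ × ℝ × ℝ) where
  toFun φ := (Test.tensor
    (φ.compHomeo (Homeomorph.subLeft ((k : ℝ) / n)) (contDiff_const.sub contDiff_id))
    (torusTest k n)).compHomeo coordChange (by
      change ContDiff ℝ ∞ (fun p : ℝ × ℝ × ℝ => (p.2.1, p.1, p.2.2 - p.1 * p.2.1))
      fun_prop)
  map_add' _ _ := TestFunction.ext fun _ => add_mul _ _ _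
  map_smul' _ _ := TestFunction.ext fun _ => mul_assoc _ _ _

/-- The abelian Fourier coefficients `c_{r,s}`. -/
def abelianCoeff {P : Params} (τ : P.Dist) (r s : ℤ) : ℂ := restrictN τ (abelianTest r s)

/-- The distribution `σ_{n,k}` on `ℝ` (for `n ≠ 0`). -/
def sigma {P : Params} (τ : P.Dist) (n k : ℤ) : Test ℝ →ₗ[ℂ] ℂ := restrictN τ ∘ₗ sigmaTest n k

/-- The distribution `ρ_{n,k}` on `ℝ` (for `n ≠ 0`). -/
def rho {P : Params} (τ : P.Dist) (n k : ℤ) : Test ℝ →ₗ[ℂ] ℂ := restrictN τ ∘ₗ rhoTest n k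

/-! ### Fourier components as distribution vectors for `SL(2, ℝ)` -/

/-- The part of `τ` transforming by the character `e(k y + n z)` of `N_{y,z}`, restricted to the upper
left copy of `SL(2, ℝ)`, as a functional on `W_{-μ,δ₃}^∞`, `μ = λ₁ - λ₂`. -/
def upperComponent {P : Params} (τ : P.Dist) (n k : ℤ) : SL2Functional P.mu12 (P.del 2) :=
  τ.toLin ∘ₗ extendUpper P (torusTest k n)

/-- The part of `τ` transforming by the character `e(k x + n w)` of `N_{x,z}`, restricted to the lower
right copy of `SL(2, ℝ)`, as a functional on `W_{-μ,δ₁}^∞`, `μ = λ₂ - λ₃`. -/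
def lowerComponent {P : Params} (τ : P.Dist) (n k : ℤ) : SL2Functional P.mu23 (P.del 0) :=
  τ.toLin ∘ₗ extendLower P (torusTest k n)

/-- The natural extension of `σ_{n,k}`: the translate by `k/n` of the component of `τ` of index
`(n, k)`. -/
def sigmaVec {P : Params} (τ : P.Dist) (n k : ℤ) : SL2Functional P.mu12 (P.del 2) :=
  psi _ _ (unip ((k : ℝ) / n)) (upperComponent τ n k)

/-- The natural extension of `ρ_{n,k}`: the reflection of the component of `τ` of index `(n, k)`,
translated by `k/n`. -/
def rhoVec {P : Params} (τ : P.Dist) (n k : ℤ) : SL2Functional P.mu23 (P.del 0) :=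
  psi _ _ (unip ((k : ℝ) / n)) (reflect _ _ (lowerComponent τ n k))

/-- The natural extension of `∑_r c_{r,q} e(r x)`. -/
def rowVec {P : Params} (τ : P.Dist) (q : ℤ) : SL2Functional P.mu12 (P.del 2) :=
  upperComponent τ 0 q

/-- The natural extension of `∑_s c_{q,s} e(s y)`. -/
def colVec {P : Params} (τ : P.Dist) (q : ℤ) : SL2Functional P.mu23 (P.del 0) :=
  lowerComponent τ 0 q

end GL3Automorphic

end

open GL3Automorphic

/-!
# Fourier components of automorphic distributions for `GL(3, ℤ)`

The integral points of the two maximal parabolic subgroups of `GL(3)` containing `N` do all the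
work. For a fixed vector `F` in the principal series of the upper left `SL(2, ℝ)`, the functional
`Φ ↦ τ(extendUpper Φ F)` is a distribution in `(y, z)` which is periodic under `ℤ²`; the block
`SL(2, ℤ)` acts linearly on `(y, z)` and on `F` at the same time. Passing to Fourier coefficients,
the component of `τ` with character `(n, k)`, evaluated at `F`, equals the component with character
`(n, k) A`, evaluated at `F ∘ A`, for every `A ∈ SL(2, ℤ)`
(`IsEquivariantFamily.torusTest_eq`). The lower right copy of `SL(2, ℝ)` acts on `(x, w)` in the
contragredient way, and after the reflection `x ↦ -x` it obeys exactly the same rule. Both cases are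
therefore instances of `IsEquivariantFamily`, and all identities between vectors are special cases of
this rule: `A = (1, 1; 0, 1)` shows that `σ_{n,k}` and `ρ_{n,k}` depend on `k` modulo `n`,
`A = (ā, b; c, a)` carries `(0, q)` to `(c q, a q)`, and the trivial character is fixed by the Weyl
element and by `-1`, the latter acting by the sign of the parity.

A Fourier coefficient is defined by pairing with a cutoff function whose integral translates sum up
to `1`. That the choice of the cutoff does not matter is a rearrangement of finite sums
(`eq_of_periodization`), so it holds for any additive invariant functional.

Continuity of `τ` enters in two places. It shows that the components are distribution vectors: on a
compact set the derivatives of `u · (F ∘ c)` are bounded by those of `F`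
(`exists_bound_mul_comp`). It also shows that the periodic distribution obtained by restricting the
component with character `(0, q)` to the line is the sum of its Fourier series
(`hasSum_fourier_of_periodic`): by Poisson summation the periodization of a test function is a Fourier
series with rapidly decreasing coefficients, which converges with all its derivatives. The explicit
series for `σ_{cq,aq}` and `ρ_{cq,aq}` away from the origin then follow from the identities between
vectors by the substitution `x = ā / c - 1 / (c² y)`
(`hasSum_restrictLine_of_psi_cuspMatrix`).
-/

noncomputable section

attribute [local instance] Matrix.normedAddCommGroup Matrix.normedSpace

namespace GL3Automorphic

/-! ### Derivatives of weighted pullbacks -/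

lemma exists_bound_iteratedFDeriv {E G : Type*} [NormedAddCommGroup E] [NormedSpace ℝ E]
    [NormedAddCommGroup G] [NormedSpace ℝ G] {Ω L : Set E} (hΩ : IsOpen Ω) {u : E → G}
    (hu : ContDiffOn ℝ ∞ u Ω) (hL : IsCompact L) (hLΩ : L ⊆ Ω) (m : ℕ) :
    ∃ M : ℝ, 1 ≤ M ∧ ∀ i ≤ m, ∀ x ∈ L, ‖iteratedFDerivWithin ℝ i u Ω x‖ ≤ M := by
  have h : ∀ i : ℕ, ∃ M : ℝ, ∀ x ∈ L, ‖iteratedFDerivWithin ℝ i u Ω x‖ ≤ M := fun i =>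
    hL.exists_bound_of_continuousOn ((hu.continuousOn_iteratedFDerivWithin
      (by exact_mod_cast le_top) hΩ.uniqueDiffOn).mono hLΩ)
  choose M hM using h
  refine ⟨1 + ∑ i ∈ Finset.range (m + 1), |M i|,
    le_add_of_nonneg_right (Finset.sum_nonneg fun _ _ => abs_nonneg _), fun i hi x hx => ?_⟩
  have h1 := Finset.single_le_sum (f := fun i => |M i|) (fun _ _ => abs_nonneg _)
    (Finset.mem_range.2 (Nat.lt_succ_of_le hi))
  linarith [hM i x hx, le_abs_self (M i)]

/-- The derivatives of order at most `m` of `u · (F ∘ c)` on a compact set `L`, for fixed smooth `u`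
and `c`, are controlled by those of `F` on `c(L)`, uniformly in `F`. -/
lemma exists_bound_mul_comp {E E' : Type*} [NormedAddCommGroup E] [NormedSpace ℝ E]
    [NormedAddCommGroup E'] [NormedSpace ℝ E'] {Ω L : Set E} {Ω' : Set E'} (hΩ : IsOpen Ω)
    (hΩ' : IsOpen Ω') {u : E → ℂ} {c : E → E'} (hu : ContDiffOn ℝ ∞ u Ω)
    (hc : ContDiffOn ℝ ∞ c Ω) (hcΩ : Set.MapsTo c Ω Ω') (hL : IsCompact L) (hLΩ : L ⊆ Ω) (m : ℕ) :
    ∃ C : ℝ, ∀ F : E' → ℂ, ContDiffOn ℝ ∞ F Ω' → ∀ B : ℝ, 0 ≤ B →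
      (∀ i ≤ m, ∀ v ∈ c '' L, ‖iteratedFDeriv ℝ i F v‖ ≤ B) →
      ∀ i ≤ m, ∀ g ∈ L, ‖iteratedFDeriv ℝ i (fun g => u g * F (c g)) g‖ ≤ C * B := by
  obtain ⟨M, hM1, hM⟩ := exists_bound_iteratedFDeriv hΩ hu hL hLΩ m
  obtain ⟨D, hD1, hD⟩ := exists_bound_iteratedFDeriv hΩ hc hL hLΩ m
  have hle : ∀ i : ℕ, (i : ℕ∞ω) ≤ ∞ := fun i => by exact_mod_cast le_top
  refine ⟨2 ^ m * M * (m.factorial * D ^ m), fun F hF B hB hFB i hi g hg => ?_⟩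
  have hcomp : ∀ j ≤ m, ‖iteratedFDerivWithin ℝ j (F ∘ c) Ω g‖ ≤ m.factorial * D ^ m * B := by
    intro j hj
    have h1 := norm_iteratedFDerivWithin_comp_le (n := j) (C := B) (D := D) hF hc (hle j)
      hΩ'.uniqueDiffOn hΩ.uniqueDiffOn hcΩ (hLΩ hg)
      (fun k hk => by
        rw [iteratedFDerivWithin_of_isOpen k hΩ' (hcΩ (hLΩ hg))]
        exact hFB k (hk.trans hj) _ ⟨g, hg, rfl⟩)
      (fun k hk1 hk => (hD k (hk.trans hj) g hg).trans (le_self_pow₀ hD1 (by omega)))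
    refine h1.trans ?_
    have h2 : (j.factorial : ℝ) ≤ m.factorial := by exact_mod_cast Nat.factorial_le hj
    have h3 : D ^ j ≤ D ^ m := pow_le_pow_right₀ hD1 hj
    calc (j.factorial : ℝ) * B * D ^ j ≤ m.factorial * B * D ^ m := by gcongr
      _ = _ := by ring
  rw [← iteratedFDerivWithin_of_isOpen i hΩ (hLΩ hg)]
  have hFc : ContDiffOn ℝ ∞ (F ∘ c) Ω := hF.comp hc hcΩ
  refine (norm_iteratedFDerivWithin_mul_le hu hFc hΩ.uniqueDiffOn (hLΩ hg) (hle i)).trans ?_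
  have hD0 : 0 ≤ D := zero_le_one.trans hD1
  have hM0 : 0 ≤ M := zero_le_one.trans hM1
  calc ∑ j ∈ Finset.range (i + 1), (i.choose j : ℝ) * ‖iteratedFDerivWithin ℝ j u Ω g‖ *
        ‖iteratedFDerivWithin ℝ (i - j) (F ∘ c) Ω g‖
      ≤ ∑ j ∈ Finset.range (i + 1), (i.choose j : ℝ) * (M * (m.factorial * D ^ m * B)) := by
        refine Finset.sum_le_sum fun j hj => ?_
        have hj' : j ≤ i := Nat.le_of_lt_succ (Finset.mem_range.1 hj)
        rw [mul_assoc]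
        gcongr
        · exact hM j (hj'.trans hi) g hg
        · exact hcomp _ ((Nat.sub_le _ _).trans hi)
    _ = 2 ^ i * (M * (m.factorial * D ^ m * B)) := by
        rw [← Finset.sum_mul]
        congr 1
        exact_mod_cast Nat.sum_range_choose i
    _ ≤ 2 ^ m * (M * (m.factorial * D ^ m * B)) := by
        gcongr
        norm_num
    _ = _ := by ring

/-- The form of `exists_bound_mul_comp` for functions which agree with `u · (F ∘ c)` near the points
of `L` and vanish near the remaining points of `K`. -/
lemma exists_bound_of_eventuallyEq {E E' : Type*} [NormedAddCommGroup E] [NormedSpace ℝ E]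
    [NormedAddCommGroup E'] [NormedSpace ℝ E'] {Ω L : Set E} {Ω' : Set E'} (K : Set E)
    (hΩ : IsOpen Ω) (hΩ' : IsOpen Ω') {u : E → ℂ} {c : E → E'} (hu : ContDiffOn ℝ ∞ u Ω)
    (hc : ContDiffOn ℝ ∞ c Ω) (hcΩ : Set.MapsTo c Ω Ω') (hL : IsCompact L) (hLΩ : L ⊆ Ω) (m : ℕ) :
    ∃ C : ℝ, 0 ≤ C ∧ ∀ (F : E' → ℂ) (f : E → ℂ), ContDiffOn ℝ ∞ F Ω' →
      (∀ g ∈ L, f =ᶠ[𝓝 g] fun g => u g * F (c g)) → (∀ g ∈ K, g ∉ L → f =ᶠ[𝓝 g] 0) →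
      ∀ B : ℝ, 0 ≤ B → (∀ i ≤ m, ∀ v ∈ c '' L, ‖iteratedFDeriv ℝ i F v‖ ≤ B) →
      ∀ i ≤ m, ∀ g ∈ K, ‖iteratedFDeriv ℝ i f g‖ ≤ C * B := by
  obtain ⟨C, hC⟩ := exists_bound_mul_comp hΩ hΩ' hu hc hcΩ hL hLΩ m
  refine ⟨|C|, abs_nonneg C, fun F f hF hfL hfK B hB hFB i hi g hg => ?_⟩
  by_cases hgL : g ∈ L
  · rw [(Filter.EventuallyEq.iteratedFDeriv ℝ (hfL g hgL) i).eq_of_nhds]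
    exact (hC F hF B hB hFB i hi g hgL).trans (mul_le_mul_of_nonneg_right (le_abs_self C) hB)
  · rw [(Filter.EventuallyEq.iteratedFDeriv ℝ (hfK g hg hgL) i).eq_of_nhds]
    have h0 : iteratedFDeriv ℝ i (0 : E → ℂ) g = 0 := by
      have := congrFun (iteratedFDeriv_fun_zero (𝕜 := ℝ) (E := E) (F := ℂ) (n := i)) g
      exact this
    rw [h0, norm_zero]
    positivity

/-! ### Test functions with equal periodizations -/

section Periodization

variable {E : Type*} [NormedAddCommGroup E] [NormedSpace ℝ E]

/-- The translate `x ↦ φ(x + v)` of a test function. -/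
def Test.shift (φ : Test E) (v : E) : Test E :=
  φ.compHomeo (Homeomorph.addRight v) (contDiff_id.add contDiff_const)

@[simp] lemma Test.shift_apply (φ : Test E) (v x : E) : φ.shift v x = φ (x + v) := rfl

@[simp] lemma Test.mulSmooth_apply (φ : Test E) (u : E → ℂ) (hu : ContDiff ℝ ∞ u) (x : E) :
    φ.mulSmooth u hu x = u x * φ x := rfl

lemma Test.sum_apply {ι : Type*} (S : Finset ι) (f : ι → Test E) (x : E) :
    (∑ i ∈ S, f i) x = ∑ i ∈ S, f i x := by
  classical
  induction S using Finset.induction_on with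
  | empty => rfl
  | insert a S ha ih =>
    rw [Finset.sum_insert ha, Finset.sum_insert ha, ← ih]
    rfl

/-- Let `θ` be a smooth function whose translates by a lattice sum up to `1`. An additive functional
on test functions which is invariant under the lattice takes the same value at `ψ` and at `P θ`, where
`P` is the periodization of `ψ`. Only finite sums of test functions enter, so that no continuity of
the functional is needed. -/
lemma eq_of_periodization {Λ : Type*} [AddGroup Λ] (ℓ : Λ →+ E) (T : Test E →+ ℂ)
    (hT : ∀ m φ, T (φ.shift (ℓ m)) = T φ) (θ : E → ℂ) (hθ : ContDiff ℝ ∞ θ)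
    (hsum : ∀ x, HasSum (fun m => θ (x + ℓ m)) 1)
    (hfin : ∀ R : ℝ, {m : Λ | ∃ x, ‖x‖ ≤ R ∧ θ (x + ℓ m) ≠ 0}.Finite)
    (ψ ψ' : Test E) (P : E → ℂ) (hP : ∀ x, HasSum (fun m => ψ (x + ℓ m)) (P x))
    (hψ' : ∀ x, ψ' x = P x * θ x) : T ψ = T ψ' := by
  obtain ⟨R, -, hR⟩ := ψ.exists_bound
  set S := (hfin R).toFinset with hS
  have hS' : ∀ m ∉ S, ∀ x, ψ x * θ (x + ℓ m) = 0 := by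
    intro m hm x
    by_contra h
    exact hm ((hfin R).mem_toFinset.2
      ⟨x, hR x (left_ne_zero_of_mul h), right_ne_zero_of_mul h⟩)
  -- The pieces `h m` of `ψ` add up to `ψ`, and their translates by `-ℓ m` add up to `ψ'`.
  set h : Λ → Test E := fun m => ψ.mulSmooth (fun x => θ (x + ℓ m))
    (hθ.comp (contDiff_id.add contDiff_const)) with hh
  have e1 : ψ = ∑ m ∈ S, h m := by
    refine TestFunction.ext fun x => ?_
    rw [Test.sum_apply]
    have h1 := (hsum x).mul_left (ψ x)
    rw [mul_one] at h1
    rw [← (hasSum_sum_of_ne_finset_zero fun m hm => hS' m hm x).unique h1]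
    exact Finset.sum_congr rfl fun m _ => mul_comm _ _
  have e2 : ψ' = ∑ m ∈ S, (h m).shift (ℓ (-m)) := by
    refine TestFunction.ext fun x => ?_
    rw [Test.sum_apply, hψ']
    have h1 := ((Equiv.neg Λ).hasSum_iff.2 (hP x)).mul_right (θ x)
    have h2 : ∀ m, h m (x + ℓ (-m)) = ψ (x + ℓ (-m)) * θ x := fun m => by
      simp [hh, mul_comm]
    simp only [Test.shift_apply, h2]
    refine h1.unique (hasSum_sum_of_ne_finset_zero fun m hm => ?_)
    have := hS' m hm (x + ℓ (-m))
    simpa using this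
  rw [e1, e2, map_sum, map_sum]
  exact Finset.sum_congr rfl fun m _ => (hT _ _).symm

end Periodization

/-! ### The additive character and the cutoff function -/

lemma e_add (s t : ℝ) : e (s + t) = e s * e t := by
  unfold e
  rw [← Complex.exp_add]
  congr 1
  push_cast
  ring

lemma e_intCast (n : ℤ) : e n = 1 := by
  unfold e
  rw [Complex.exp_eq_one_iff]
  exact ⟨n, by push_cast; ring⟩

lemma norm_e (t : ℝ) : ‖e t‖ = 1 := by
  unfold e
  rw [show 2 * (Real.pi : ℂ) * I * t = ((2 * Real.pi * t : ℝ) : ℂ) * I by push_cast; ring,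
    Complex.norm_exp_ofReal_mul_I]

@[simp] lemma cutoff_apply (t : ℝ) : cutoff t = (cutoffFun t : ℂ) := rfl

lemma cutoff_hasSum (t : ℝ) : HasSum (fun m : ℤ => cutoff (t + m)) 1 := by
  simpa using (Complex.hasSum_ofReal (f := fun m : ℤ => cutoffFun (t + m))).2 (cutoffFun_hasSum t)

lemma cutoff_neg (t : ℝ) : cutoff (-t) = cutoff t := by
  have h : ∀ s : ℝ, Real.smoothTransition (1 - s) = 1 - Real.smoothTransition s := fun s => by
    have := Real.smoothTransition.pos_denom s
    rw [Real.smoothTransition, Real.smoothTransition, sub_sub_cancel, eq_sub_iff_add_eq,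
      add_comm (expNegInvGlue (1 - s)), ← add_div, add_comm, div_self this.ne']
  have h1 := h t
  have h2 := h (1 + t)
  rw [show 1 - (1 + t) = -t by ring] at h2
  rw [cutoff_apply, cutoff_apply, cutoffFun, cutoffFun, h2, neg_add_eq_sub, h1, add_comm t 1]
  congr 1
  ring

lemma abs_le_of_cutoff_ne_zero {t : ℝ} (ht : cutoff t ≠ 0) : |t| ≤ 1 := by
  rw [abs_le]
  by_contra h
  exact ht (by rw [cutoff_apply, cutoffFun_eq_zero h, ofReal_zero])

lemma finite_setOf_abs_intCast_le (R : ℝ) : {m : ℤ | |(m : ℝ)| ≤ R}.Finite := by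
  refine (Set.finite_Icc (-⌈R⌉) ⌈R⌉).subset fun m hm => ?_
  have h1 : |(m : ℝ)| ≤ ⌈R⌉ := le_trans hm (Int.le_ceil R)
  rw [← Int.cast_abs, Int.cast_le, abs_le] at h1
  exact h1

/-! ### Fourier series of periodic distributions on the line -/

lemma exists_bound_iteratedFDeriv_cutoff_mul_e (i : ℕ) :
    ∃ C : ℝ, 0 ≤ C ∧ ∀ (r : ℤ) (x : ℝ),
      ‖iteratedFDeriv ℝ i (fun x => e (-(r * x)) * cutoff x) x‖ ≤ C * (1 + |(r : ℝ)|) ^ i := by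
  have he : ∀ (r : ℤ) (j : ℕ) (x : ℝ), ‖iteratedFDeriv ℝ j (fun x => e (-(r * x))) x‖ ≤
      (2 * Real.pi * (1 + |(r : ℝ)|)) ^ j := by
    intro r j x
    have h1 : ∀ j : ℕ, iteratedDeriv j (fun x : ℝ => e (-(r * x))) =
        fun x => (-(2 * Real.pi * r * I)) ^ j * e (-(r * x)) := by
      intro j
      induction j with
      | zero => simp
      | succ j ih =>
        rw [iteratedDeriv_succ, ih]
        ext y
        have h2 : HasDerivAt (fun x : ℝ => e (-(r * x)))
            (e (-(r * y)) * (2 * Real.pi * I * (-(r * 1)))) y := by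
          unfold e
          have h3 := ((((hasDerivAt_id y).const_mul (r : ℝ)).neg).ofReal_comp.const_mul
            (2 * Real.pi * I)).cexp
          simpa using h3
        rw [(h2.const_mul _).deriv]
        ring
    rw [norm_iteratedFDeriv_eq_norm_iteratedDeriv, h1, norm_mul, norm_e, mul_one, norm_pow]
    refine pow_le_pow_left₀ (norm_nonneg _) ?_ j
    have h4 : ‖-(2 * (Real.pi : ℂ) * r * I)‖ = 2 * Real.pi * |(r : ℝ)| := by
      simp [abs_of_pos Real.pi_pos]
    rw [h4]
    gcongr
    linarith
  have hb : ∀ j : ℕ, ∃ M : ℝ, ∀ x, ‖iteratedFDeriv ℝ j cutoff x‖ ≤ M := fun j =>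
    (cutoff.contDiff.continuous_iteratedFDeriv (by exact_mod_cast le_top)).bounded_above_of_compact_support
      (cutoff.hasCompactSupport.iteratedFDeriv j)
  choose M hM using hb
  have hM0 : ∀ j, 0 ≤ M j := fun j => (norm_nonneg _).trans (hM j 0)
  have hpi : (1 : ℝ) ≤ 2 * Real.pi := by linarith [Real.pi_gt_three]
  refine ⟨∑ j ∈ Finset.range (i + 1), (i.choose j : ℝ) * (2 * Real.pi) ^ i * M (i - j),
    Finset.sum_nonneg fun j _ => by have := hM0 (i - j); positivity, fun r x => ?_⟩
  refine (norm_iteratedFDeriv_mul_le (contDiff_e (by fun_prop)) cutoff.contDiff x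
    (by exact_mod_cast le_top)).trans ?_
  rw [Finset.sum_mul]
  refine Finset.sum_le_sum fun j hj => ?_
  have hj' : j ≤ i := Nat.le_of_lt_succ (Finset.mem_range.1 hj)
  have h1 : (1 : ℝ) ≤ 2 * Real.pi * (1 + |(r : ℝ)|) := by
    nlinarith [abs_nonneg (r : ℝ)]
  calc _ ≤ (i.choose j : ℝ) * (2 * Real.pi * (1 + |(r : ℝ)|)) ^ i * M (i - j) := by
        have := hM0 (i - j)
        gcongr
        · exact (he r j x).trans (pow_le_pow_right₀ h1 hj')
        · exact hM _ x
    _ = _ := by rw [mul_pow]; ring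

open FourierTransform in
lemma integral_e_mul_eq_fourier (φ : Test ℝ) (r : ℤ) :
    ∫ x : ℝ, e (r * x) * φ x =
      𝓕 (φ.hasCompactSupport.toSchwartzMap φ.contDiff) ((-r : ℤ) : ℝ) := by
  rw [SchwartzMap.fourier_coe, Real.fourier_real_eq_integral_exp_smul]
  refine MeasureTheory.integral_congr_ae (Filter.Eventually.of_forall fun x => ?_)
  simp only [smul_eq_mul, HasCompactSupport.toSchwartzMap_toFun, e]
  congr 2
  push_cast
  ring

/-- The Fourier coefficients of a test function decrease rapidly. -/
lemma summable_fourier_test (φ : Test ℝ) (k : ℕ) :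
    Summable fun r : ℤ => ‖∫ x : ℝ, e (r * x) * φ x‖ * (1 + |(r : ℝ)|) ^ k := by
  set g := FourierTransform.fourier (φ.hasCompactSupport.toSchwartzMap φ.contDiff) with hg
  obtain ⟨C, hC'⟩ : ∃ C : ℝ, ∀ x : ℝ, (1 + ‖x‖) ^ (k + 2) * ‖iteratedFDeriv ℝ 0 g x‖ ≤ C :=
    ⟨_, fun x => SchwartzMap.one_add_le_sup_seminorm_apply (𝕜 := ℝ) (m := (k + 2, 0)) (k := k + 2)
      (n := 0) le_rfl le_rfl g x⟩
  have hC : ∀ r : ℤ, (1 + |(r : ℝ)|) ^ (k + 2) * ‖∫ x : ℝ, e (r * x) * φ x‖ ≤ C := fun r => by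
    have h := hC' ((-r : ℤ) : ℝ)
    rw [norm_iteratedFDeriv_zero, hg, ← integral_e_mul_eq_fourier] at h
    simpa using h
  refine Summable.of_norm_bounded_eventually (g := fun r : ℤ => C * (1 / (r : ℝ) ^ 2))
    ((Real.summable_one_div_int_pow.2 (by norm_num)).mul_left C) ?_
  filter_upwards [Filter.eventually_cofinite_ne 0] with r hr
  have hr' : (0 : ℝ) < (r : ℝ) ^ 2 := by positivity
  rw [norm_mul, norm_norm, Real.norm_of_nonneg (by positivity), mul_one_div, le_div_iff₀ hr']
  refine le_trans ?_ (hC r)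
  have h1 : (r : ℝ) ^ 2 ≤ (1 + |(r : ℝ)|) ^ 2 := by
    rw [← sq_abs (r : ℝ)]
    gcongr
    linarith
  calc _ ≤ ‖∫ x : ℝ, e (r * x) * φ x‖ * (1 + |(r : ℝ)|) ^ k * (1 + |(r : ℝ)|) ^ 2 := by gcongr
    _ = _ := by ring

/-- The periodization of a test function is the sum of its Fourier series. -/
lemma hasSum_translates_test (φ : Test ℝ) (x : ℝ) :
    HasSum (fun m : ℤ => φ (x + m)) (∑' r : ℤ, (∫ x : ℝ, e (r * x) * φ x) * e (-(r * x))) := by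
  have h := SchwartzMap.tsum_eq_tsum_fourier (φ.hasCompactSupport.toSchwartzMap φ.contDiff) x
  have hs : Summable fun m : ℤ => φ (x + m) := by
    obtain ⟨R, -, hR⟩ := φ.exists_bound
    refine summable_of_hasFiniteSupport ((finite_setOf_abs_intCast_le (R + |x|)).subset fun m hm => ?_)
    have h1 := hR _ hm
    rw [Real.norm_eq_abs] at h1
    have h2 := abs_sub (x + m) x
    rw [add_sub_cancel_left] at h2
    exact h2.trans (by linarith)
  convert hs.hasSum using 1
  refine Eq.trans ?_ h.symm
  rw [← (Equiv.neg ℤ).tsum_eq (fun n : ℤ => FourierTransform.fourier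
    (φ.hasCompactSupport.toSchwartzMap φ.contDiff) (n : ℝ) * fourier n (x : UnitAddCircle))]
  refine tsum_congr fun r => ?_
  rw [integral_e_mul_eq_fourier, Equiv.neg_apply, fourier_coe_apply, e]
  congr 2
  push_cast
  ring

/-- A periodic functional on test functions on `ℝ` which satisfies the estimate of a distribution on
test functions supported in `[-1, 1]` is the sum of its Fourier series. -/
lemma hasSum_fourier_of_periodic (D : Test ℝ →ₗ[ℂ] ℂ) (hD : ∀ (m : ℤ) φ, D (φ.shift m) = D φ)
    {m : ℕ} {C : ℝ} (hC : ∀ φ : Test ℝ, (∀ x, 1 < |x| → φ x = 0) → ∀ B : ℝ, 0 ≤ B →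
      (∀ i ≤ m, ∀ x, ‖iteratedFDeriv ℝ i φ x‖ ≤ B) → ‖D φ‖ ≤ C * B) (φ : Test ℝ) :
    HasSum (fun r : ℤ => D (cutoff.mulSmooth (fun x => e (-(r * x))) (contDiff_e (by fun_prop))) *
      ∫ x : ℝ, e (r * x) * φ x) (D φ) := by
  set a : ℤ → ℂ := fun r => ∫ x : ℝ, e (r * x) * φ x with ha
  set t : ℤ → Test ℝ := fun r => cutoff.mulSmooth (fun x => e (-(r * x)))
    (contDiff_e (by fun_prop)) with ht
  choose K hK0 hK using exists_bound_iteratedFDeriv_cutoff_mul_e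
  set v : ℕ → ℤ → ℝ := fun i r => ‖a r‖ * (K i * (1 + |(r : ℝ)|) ^ i) with hv
  have hvs : ∀ i, Summable (v i) := fun i => by
    refine ((summable_fourier_test φ i).mul_left (K i)).congr fun r => ?_
    simp only [hv, ha]
    ring
  have hsm : ∀ r, ContDiff ℝ ∞ fun x => a r * t r x := fun r => contDiff_const.mul (t r).contDiff
  have hbd : ∀ (i : ℕ) (r : ℤ) (x : ℝ), ‖iteratedFDeriv ℝ i (fun x => a r * t r x) x‖ ≤ v i r := by
    intro i r x
    have h1 : iteratedFDeriv ℝ i (fun x => a r * t r x) x = a r • iteratedFDeriv ℝ i (t r) x :=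
      iteratedFDeriv_const_smul_apply (a := a r) (f := t r) (x := x) ((t r).contDiff.of_le (by exact_mod_cast le_top)).contDiffAt
    rw [h1, norm_smul]
    exact mul_le_mul_of_nonneg_left (hK i r x) (norm_nonneg _)
  have hsx : ∀ x, Summable fun r => a r * t r x := fun x => by
    refine Summable.of_norm_bounded (hvs 0) fun r => ?_
    simpa using hbd 0 r x
  have hsupp : ∀ x, 1 < |x| → ∀ r, t r x = 0 := by
    intro x hx r
    have : cutoff x = 0 := by
      by_contra h
      exact absurd (abs_le_of_cutoff_ne_zero h) (not_le.2 hx)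
    simp only [ht, Test.mulSmooth_apply, this, mul_zero]
  -- By Poisson summation `ψ` is `cutoff` times the periodization of `φ`, hence `D φ = D ψ`.
  set ψ : Test ℝ :=
    { toFun := fun x => ∑' r, a r * t r x
      contDiff' := contDiff_tsum (N := ⊤) hsm (fun k _ => hvs k) (fun k r x _ => hbd k r x)
      hasCompactSupport' := HasCompactSupport.intro (isCompact_Icc (a := (-1 : ℝ)) (b := 1))
        fun x hx => by
          have hx' : 1 < |x| := by
            by_contra h
            exact hx (abs_le.1 (not_lt.1 h))
          simp [hsupp x hx']
      tsupport_subset' := fun _ _ => trivial } with hψ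
  have hψa : ∀ x, ψ x = ∑' r, a r * t r x := fun _ => rfl
  have hφψ : D φ = D ψ := by
    refine eq_of_periodization (Int.castAddHom ℝ) D.toAddMonoidHom (fun m φ => hD m φ) cutoff
      cutoff.contDiff cutoff_hasSum (fun R => ?_) φ ψ _ (hasSum_translates_test φ) fun x => ?_
    · refine (finite_setOf_abs_intCast_le (1 + R)).subset ?_
      rintro m ⟨x, hx, hm⟩
      have h1 := abs_le_of_cutoff_ne_zero hm
      have h2 := abs_sub (x + m) x
      rw [add_sub_cancel_left] at h2
      exact h2.trans (add_le_add h1 hx)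
    · rw [hψa, ← tsum_mul_right]
      refine tsum_congr fun r => ?_
      simp only [ht, Test.mulSmooth_apply, ha]
      ring
  -- Estimate the remainder of the Fourier series by the tails of the series bounding its derivatives.
  have hest : ∀ s : Finset ℤ, ‖D φ - ∑ r ∈ s, D (t r) * a r‖ ≤
      C * ∑ i ∈ Finset.range (m + 1), ∑' r : {r // r ∉ s}, v i r := by
    intro s
    have h1 : D φ - ∑ r ∈ s, D (t r) * a r = D (ψ - ∑ r ∈ s, a r • t r) := by
      rw [map_sub, map_sum, hφψ]
      simp [mul_comm]
    have h2 : ⇑(ψ - ∑ r ∈ s, a r • t r) = fun x => ∑' r : {r // r ∉ s}, a r * t r x := by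
      ext x
      have h3 : (ψ - ∑ r ∈ s, a r • t r) x = ψ x - ∑ r ∈ s, a r * t r x := by
        change ψ x - (∑ r ∈ s, a r • t r) x = _
        rw [Test.sum_apply]
        rfl
      rw [h3, hψa, ← (hsx x).sum_add_tsum_subtype_compl s, add_sub_cancel_left]
    have hpos : ∀ i (r : {r // r ∉ s}), 0 ≤ v i r := fun i r => by
      have := hK0 i
      simp only [hv]
      positivity
    have hsv : ∀ i, Summable (fun r : {r // r ∉ s} => v i r) := fun i =>
      (hvs i).subtype {r | r ∉ s}
    rw [h1]
    refine hC _ (fun x hx => ?_) _ (Finset.sum_nonneg fun i _ => tsum_nonneg (hpos i))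
      fun i hi x => ?_
    · rw [h2]
      simp [hsupp x hx]
    · rw [h2, iteratedFDeriv_tsum_apply (N := ⊤) (v := fun k (r : {r // r ∉ s}) => v k r)
        (fun r => hsm r) (fun k _ => hsv k) (fun k r x _ => hbd k r x) le_top]
      have h4 : HasSum (fun r : {r // r ∉ s} => v i r) (∑' r : {r // r ∉ s}, v i r) :=
        (hsv i).hasSum
      refine (tsum_of_norm_bounded h4 fun r => hbd i (r : ℤ) x).trans ?_
      exact Finset.single_le_sum (f := fun i => ∑' r : {r // r ∉ s}, v i r)
        (fun i _ => tsum_nonneg (hpos i)) (Finset.mem_range.2 (Nat.lt_succ_of_le hi))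
  change Filter.Tendsto _ _ _
  rw [tendsto_iff_norm_sub_tendsto_zero]
  refine squeeze_zero (g := fun s : Finset ℤ =>
    C * ∑ i ∈ Finset.range (m + 1), ∑' r : {r // r ∉ s}, v i r) (fun _ => norm_nonneg _)
    (fun s => ?_) ?_
  · rw [norm_sub_rev]
    exact hest s
  have h5 : Filter.Tendsto (fun s : Finset ℤ => ∑ i ∈ Finset.range (m + 1),
      ∑' r : {r // r ∉ s}, v i r) Filter.atTop (𝓝 (∑ i ∈ Finset.range (m + 1), 0)) :=
    tendsto_finsetSum _ fun i _ => tendsto_tsum_compl_atTop_zero (v i)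
  simpa using h5.const_mul C

/-! ### Distribution vectors for `SL(2, ℝ)` -/

section SL2

variable {μ : ℂ} {η : ZMod 2}

lemma IsSL2DistVector.comp_pullback {S : SL2Functional μ η} (hS : IsSL2DistVector S)
    (A : Matrix (Fin 2) (Fin 2) ℝ) (hA : A.det ≠ 0) :
    IsSL2DistVector (S ∘ₗ SL2Smooth.pullback (-μ) η A hA : SL2Functional μ η) := by
  obtain ⟨K, m, C, hK, hK0, hC⟩ := hS
  have hact : ContDiff ℝ ∞ (act2 A) := by
    unfold act2
    fun_prop
  obtain ⟨C', hC'0, hC'⟩ := exists_bound_of_eventuallyEq (L := K) (Ω := {v : ℝ × ℝ | v ≠ 0})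
    (Ω' := {v : ℝ × ℝ | v ≠ 0}) K isOpen_ne isOpen_ne (u := fun _ => 1) contDiffOn_const
    hact.contDiffOn (fun v hv => act2_ne_zero hA hv) hK hK0 m
  refine ⟨act2 A '' K, m, C * C', hK.image hact.continuous, ?_, fun F B hB hF => ?_⟩
  · rintro _ ⟨v, hv, rfl⟩
    exact act2_ne_zero hA (hK0 hv)
  · rw [mul_assoc]
    refine hC _ _ (mul_nonneg hC'0 hB) (hC' F.1 _ F.2.2.1 (fun g _ => ?_)
      (fun g h1 h2 => absurd h1 h2) B hB hF)
    filter_upwards with g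
    simp [SL2Smooth.pullback]

lemma IsSL2DistVector.psi {S : SL2Functional μ η} (hS : IsSL2DistVector S) (g : SL(2, ℝ)) :
    IsSL2DistVector (psi μ η g S) :=
  hS.comp_pullback _ _

lemma IsSL2DistVector.reflect {S : SL2Functional μ η} (hS : IsSL2DistVector S) :
    IsSL2DistVector (reflect μ η S) :=
  hS.comp_pullback _ _

/-- On test functions supported in `[-1, 1]`, the restriction to `ℝ` of a distribution vector is
bounded by finitely many derivatives. -/
lemma IsSL2DistVector.exists_bound_restrictLine {S : SL2Functional μ η} (hS : IsSL2DistVector S) :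
    ∃ (m : ℕ) (C : ℝ), ∀ φ : Test ℝ, (∀ x, 1 < |x| → φ x = 0) → ∀ B : ℝ, 0 ≤ B →
      (∀ i ≤ m, ∀ x, ‖iteratedFDeriv ℝ i φ x‖ ≤ B) → ‖restrictLine S φ‖ ≤ C * B := by
  obtain ⟨K, m, C, hK, hK0, hC⟩ := hS
  have hL : IsCompact (K ∩ {v : ℝ × ℝ | |v.1| ≤ |v.2|}) :=
    hK.inter_right (isClosed_le (by fun_prop) (by fun_prop))
  have hne : ∀ v ∈ K ∩ {v : ℝ × ℝ | |v.1| ≤ |v.2|}, v.2 ≠ 0 := by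
    rintro v ⟨hv, hle⟩ h2
    simp only [Set.mem_ofPred_eq, h2, abs_zero, abs_nonpos_iff] at hle
    exact hK0 hv (Prod.ext hle h2)
  obtain ⟨C', hC'0, hC'⟩ := exists_bound_of_eventuallyEq (Ω := {v : ℝ × ℝ | v.2 ≠ 0})
    (Ω' := (Set.univ : Set ℝ)) K (isOpen_ne.preimage continuous_snd) isOpen_univ
    (u := fun v => quasiChar η (-μ - 1) v.2) (c := fun v => v.1 / v.2)
    (fun v hv => ((contDiffAt_quasiChar η _ hv).comp v contDiffAt_snd).contDiffWithinAt)
    (fun v hv => (contDiffAt_fst.div contDiffAt_snd hv).contDiffWithinAt)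
    (fun _ _ => trivial) hL hne m
  refine ⟨m, C * C', fun φ hφ B hB hφB => ?_⟩
  rw [mul_assoc]
  refine hC _ _ (mul_nonneg hC'0 hB) (hC' φ _ φ.contDiff.contDiffOn (fun v hv => ?_)
    (fun v hv hvL => ?_) B hB fun i hi x _ => hφB i hi x)
  · filter_upwards [continuousAt_snd.eventually_ne (hne v hv)] with w hw
    simp [lineSection, hw]
  · have hlt : |v.2| < |v.1| := by
      by_contra h
      exact hvL ⟨hv, not_lt.1 h⟩
    filter_upwards [ContinuousAt.eventually_lt (f := fun w : ℝ × ℝ => |w.2|)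
      (g := fun w : ℝ × ℝ => |w.1|) (by fun_prop) (by fun_prop) hlt] with w hw
    by_cases h : w.2 = 0
    · simp [lineSection, h]
    · have : φ (w.1 / w.2) = 0 := hφ _ (by rw [abs_div, one_lt_div (abs_pos.2 h)]; exact hw)
      simp [lineSection, this]

lemma lineSection_apply (φ : Test ℝ) (v : ℝ × ℝ) : (lineSection μ η φ).1 v =
    if v.2 = 0 then 0 else quasiChar η (μ - 1) v.2 * φ (v.1 / v.2) := rfl

lemma psi_apply (g : SL(2, ℝ)) (S : SL2Functional μ η) (F : SL2Smooth (-μ) η) :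
    psi μ η g S F = S (SL2Smooth.pullback (-μ) η g (by rw [g.2]; exact one_ne_zero) F) := rfl

lemma restrictLine_psi_unip (t : ℝ) (S : SL2Functional μ η) (φ : Test ℝ) :
    restrictLine (psi μ η (unip t) S) φ = restrictLine S (φ.shift t) := by
  change S _ = S _
  congr 1
  refine Subtype.ext (funext fun v => ?_)
  simp only [SL2Smooth.pullback, LinearMap.coe_mk, AddHom.coe_mk, lineSection_apply, act2, unip,
    Test.shift_apply]
  simp only [Matrix.of_apply, Matrix.cons_val', Matrix.cons_val_zero, Matrix.cons_val_one,
    Matrix.cons_val_fin_one, one_mul, zero_mul, zero_add]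
  split_ifs with h
  · rfl
  · congr 2
    field_simp

/-- A vector `F` which vanishes near the point at infinity of the line is the extension by zero of a
test function. -/
lemma exists_lineSection_eq (F : SL2Smooth μ η) (h0 : F.1 (1, 0) = 0)
    (hc : HasCompactSupport fun x : ℝ => F.1 (x, 1)) :
    ∃ φ : Test ℝ, (∀ x, φ x = F.1 (x, 1)) ∧ lineSection μ η φ = F := by
  have hne : ∀ x : ℝ, ((x, 1) : ℝ × ℝ) ≠ 0 := fun x h => one_ne_zero (congrArg Prod.snd h)
  refine ⟨⟨fun x => F.1 (x, 1), ?_, hc, fun _ _ => trivial⟩, fun _ => rfl,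
    Subtype.ext (funext fun v => ?_)⟩
  · refine contDiff_iff_contDiffAt.2 fun x => ?_
    exact (F.2.2.1.contDiffAt (isOpen_ne.mem_nhds (hne x))).comp x
      (contDiffAt_id.prodMk contDiffAt_const)
  · rw [lineSection_apply]
    split_ifs with h
    · by_cases h1 : v.1 = 0
      · rw [show v = 0 from Prod.ext h1 h]
        exact F.2.1.symm
      · have := F.2.2.2 v.1 (1, 0) h1 (fun h => one_ne_zero (congrArg Prod.fst h))
        rw [h0, mul_zero] at this
        rw [← this]
        exact congrArg F.1 (Prod.ext (by simp) (by simp [h]))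
    · have := F.2.2.2 v.2 (v.1 / v.2, 1) h (hne _)
      refine Eq.trans this.symm (congrArg F.1 (Prod.ext ?_ ?_))
      · simp [mul_div_cancel₀ _ h]
      · simp

lemma quasiChar_inv_mul_inv_sq (μ : ℂ) (η : ZMod 2) {t : ℝ} (ht : t ≠ 0) :
    quasiChar η (-μ - 1) t⁻¹ * (((t ^ 2)⁻¹ : ℝ) : ℂ) = quasiChar η (μ - 1) t := by
  have h1 := quasiChar_add η η (-μ - 1) (μ - 1) ht
  have hηη : η + η = 0 := by
    have : ∀ η : ZMod 2, η + η = 0 := by decide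
    exact this η
  have h2 : quasiChar 0 (-2) t = (((t ^ 2)⁻¹ : ℝ) : ℂ) := by
    rw [quasiChar, if_pos rfl, one_mul, ← sq_abs]
    have h3 := cpow_neg ((|t| : ℝ) : ℂ) 2
    rw [h3]
    have h4 := cpow_natCast ((|t| : ℝ) : ℂ) 2
    push_cast at h4 ⊢
    rw [h4]
  rw [hηη, show -μ - 1 + (μ - 1) = -2 by ring, h2] at h1
  rw [h1, ← mul_assoc, ← quasiChar_mul, inv_mul_cancel₀ ht, quasiChar_one, one_mul]

/-- The substitution `x = p - 1 / (c² y)` on the real line. The junk value at `y = 0` concerns a null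
set only. -/
lemma integral_substitution (p c : ℝ) (hc : c ≠ 0) (f : ℝ → ℂ) :
    ∫ x, f x = ∫ y : ℝ, (((c * y) ^ 2)⁻¹ : ℝ) • f (p - 1 / (c ^ 2 * y)) := by
  have hinj : Set.InjOn (fun y : ℝ => p - 1 / (c ^ 2 * y)) {0}ᶜ := by
    intro y hy y' hy' h
    simp only [Set.mem_compl_iff, Set.mem_singleton_iff] at hy hy'
    simp only [sub_right_inj] at h
    field_simp at h
    exact h.symm
  have himg : (fun y : ℝ => p - 1 / (c ^ 2 * y)) '' {0}ᶜ = {p}ᶜ := by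
    ext x
    simp only [Set.mem_image, Set.mem_compl_iff, Set.mem_singleton_iff]
    constructor
    · rintro ⟨y, hy, rfl⟩ h
      have : 1 / (c ^ 2 * y) = 0 := by linarith
      rw [one_div, inv_eq_zero] at this
      exact hy ((mul_eq_zero.1 this).resolve_left (pow_ne_zero 2 hc))
    · intro hx
      have h1 : p - x ≠ 0 := sub_ne_zero.2 (Ne.symm hx)
      refine ⟨1 / (c ^ 2 * (p - x)), by positivity, ?_⟩
      field_simp
      ring
  have hder : ∀ y ∈ ({0}ᶜ : Set ℝ), HasDerivWithinAt (fun y : ℝ => p - 1 / (c ^ 2 * y))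
      (((c * y) ^ 2)⁻¹) {0}ᶜ y := by
    intro y hy
    have hy' : y ≠ 0 := hy
    have h1 := (((hasDerivAt_id y).const_mul (c ^ 2)).inv (mul_ne_zero (pow_ne_zero 2 hc) hy')).const_sub p
    simp only [id, mul_one] at h1
    refine HasDerivAt.hasDerivWithinAt ?_
    convert h1 using 1
    · ext y
      simp
    · field_simp
  have h := MeasureTheory.integral_image_eq_integral_abs_deriv_smul
    (MeasurableSet.compl (MeasurableSet.singleton (0 : ℝ))) hder hinj f
  rw [himg] at h
  have habs : ∀ y : ℝ, |((c * y) ^ 2)⁻¹| = ((c * y) ^ 2)⁻¹ := fun y =>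
    abs_of_nonneg (inv_nonneg.2 (sq_nonneg _))
  simp only [habs] at h
  have hr : ∀ a : ℝ, MeasureTheory.volume.restrict ({a}ᶜ : Set ℝ) = MeasureTheory.volume :=
    fun a => MeasureTheory.Measure.restrict_eq_self_of_ae_mem
      (MeasureTheory.measure_eq_zero_iff_ae_notMem.1 (MeasureTheory.measure_singleton a))
  rwa [hr, hr] at h

/-- If `S = ψ(ā, -1/c; c, 0) S'` and the restriction of `S` to the line is the trigonometric series
`∑ d_r e(r x)`, then the restriction of `S'` to `ℝ - {0}` is the transformed series. -/
lemma hasSum_restrictLine_of_psi_cuspMatrix {S S' : SL2Functional μ η} {abar c : ℤ} (hc : c ≠ 0)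
    (hS : S = psi μ η (cuspMatrix abar c hc) S') {d : ℤ → ℂ}
    (hd : ∀ φ : Test ℝ, HasSum (fun r : ℤ => d r * ∫ x : ℝ, e (r * x) * φ x) (restrictLine S φ))
    (φ : Test ℝ) (hφ : (0 : ℝ) ∉ tsupport φ) :
    HasSum (fun r : ℤ => d r * ∫ x : ℝ, quasiChar η (μ - 1) (c * x) *
      e (r * abar / c - r / (c ^ 2 * x)) * φ x) (restrictLine S' φ) := by
  have hcR : (c : ℝ) ≠ 0 := by exact_mod_cast hc
  have hφ0 : φ 0 = 0 := image_eq_zero_of_notMem_tsupport hφ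
  -- `G` is the pullback of the section of `φ` by the inverse of `cuspMatrix abar c hc`; it comes from a
  -- test function because `φ` vanishes near `0`, the image of the point at infinity.
  set G := SL2Smooth.pullback (-μ) η !![0, (c : ℝ)⁻¹; -(c : ℝ), (abar : ℝ)] (by simp [hcR])
    (lineSection (-μ) η φ) with hG
  have hGv : ∀ v : ℝ × ℝ, G.1 v =
      (lineSection (-μ) η φ).1 ((c : ℝ)⁻¹ * v.2, -c * v.1 + abar * v.2) := by
    intro v
    simp [hG, SL2Smooth.pullback, act2]
  have hGx : ∀ x : ℝ, G.1 (x, 1) = if abar - c * x = 0 then 0 else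
      quasiChar η (-μ - 1) (abar - c * x) * φ ((c : ℝ)⁻¹ / (abar - c * x)) := by
    intro x
    rw [hGv, lineSection_apply]
    simp only [mul_one, show -(c : ℝ) * x + abar = abar - c * x by ring]
  obtain ⟨ψ, hψ, hψG⟩ := exists_lineSection_eq G (by
    rw [hGv, lineSection_apply]
    simp [hφ0]) (by
    obtain ⟨ε, hε, hball⟩ := Metric.isOpen_iff.1 (isClosed_tsupport φ).isOpen_compl 0 hφ
    refine HasCompactSupport.intro (isCompact_closedBall (0 : ℝ)
      ((|(abar : ℝ)| + |(c : ℝ)|⁻¹ / ε) / |(c : ℝ)|)) fun x hx => ?_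
    rw [hGx]
    split_ifs with h
    · rfl
    · rw [mul_eq_zero]
      right
      refine image_eq_zero_of_notMem_tsupport (hball ?_)
      rw [Metric.mem_closedBall, dist_zero_right, Real.norm_eq_abs, not_le,
        div_lt_iff₀ (abs_pos.2 hcR)] at hx
      rw [Metric.mem_ball, dist_zero_right, Real.norm_eq_abs, abs_div, abs_inv,
        div_lt_iff₀ (abs_pos.2 h), mul_comm, ← div_lt_iff₀ hε]
      have h1 : |(c : ℝ) * x| ≤ |(abar : ℝ) - c * x| + |(abar : ℝ)| := by
        have := abs_sub ((abar : ℝ) - c * x) abar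
        rwa [sub_sub_cancel_left, abs_neg] at this
      rw [abs_mul] at h1
      linarith [mul_comm |x| |(c : ℝ)|])
  have hval : restrictLine S' φ = restrictLine S ψ := by
    change S' _ = S _
    rw [hψG, hS, psi_apply]
    congr 1
    refine Subtype.ext (funext fun v => ?_)
    change _ = G.1 (act2 _ v)
    rw [hGv]
    refine congrArg (lineSection (-μ) η φ).1 (Prod.ext ?_ ?_) <;> simp only [act2, cuspMatrix]
    · simp [hcR]
    · simp
      field_simp
      ring
  rw [hval]
  convert hd ψ using 3 with r
  symm
  rw [integral_substitution (abar / c) c hcR]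
  refine MeasureTheory.integral_congr_ae (Filter.Eventually.of_forall fun y => ?_)
  simp only [hψ, hGx]
  by_cases hy : y = 0
  · simp [hy, hφ0]
  · have hcy : (c : ℝ) * y ≠ 0 := mul_ne_zero hcR hy
    have h1 : (abar : ℝ) - c * (abar / c - 1 / (c ^ 2 * y)) = (c * y)⁻¹ := by
      field_simp
      ring
    have h2 : (c : ℝ)⁻¹ / (c * y)⁻¹ = y := by field_simp
    have h3 : (r : ℝ) * (abar / c - 1 / (c ^ 2 * y)) = r * abar / c - r / (c ^ 2 * y) := by ring
    rw [h1, if_neg (inv_ne_zero hcy), h2, h3, ← quasiChar_inv_mul_inv_sq μ η hcy, Complex.real_smul]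
    ring

end SL2

/-! ### Fourier components of an equivariant family -/

/-- The properties of the functionals `Φ ↦ B Φ` on test functions on `ℝ²`, with values in the
functionals on `W_{-μ,η}^∞`, which express the invariance of `τ` under the integral points of a
maximal parabolic subgroup: `ℤ²` acts on `Φ` by translations, and `SL(2, ℤ)` acts on `Φ` and on
`F ∈ W_{-μ,η}^∞` simultaneously. If `Φ` is a function of `(u, v)`, it is the column `(v, u)` that a
matrix multiplies, as `(z, y)` is the upper part of the third column of an element of `N`. The components of `τ` restricted to the upper left and, up to a
reflection, to the lower right copy of `SL(2, ℝ)` are both of this kind. -/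
structure IsEquivariantFamily {μ : ℂ} {η : ZMod 2} (B : Test (ℝ × ℝ) → SL2Functional μ η) :
    Prop where
  add : ∀ Φ Φ' F, B (Φ + Φ') F = B Φ F + B Φ' F
  shift : ∀ (m l : ℤ) Φ F, B (Φ.shift ((m : ℝ), (l : ℝ))) F = B Φ F
  sl2 : ∀ α β γ d : ℤ, α * d - β * γ = 1 → ∀ Φ Φ' : Test (ℝ × ℝ),
    (∀ p, Φ' p = Φ (d * p.1 + γ * p.2, β * p.1 + α * p.2)) → ∀ F F' : SL2Smooth (-μ) η,
    (∀ v, F'.1 v = F.1 (act2 !![(α : ℝ), (β : ℝ); (γ : ℝ), (d : ℝ)] v)) → B Φ F = B Φ' F'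
  isSL2DistVector : ∀ Φ, IsSL2DistVector (B Φ)

/-- The action of an element of `SL(2, ℤ)` on `ℝ²` in the coordinates of
`IsEquivariantFamily.sl2`. -/
def planeHomeo {α β γ d : ℤ} (h : α * d - β * γ = 1) : (ℝ × ℝ) ≃ₜ (ℝ × ℝ) where
  toFun p := (d * p.1 + γ * p.2, β * p.1 + α * p.2)
  invFun p := (α * p.1 - γ * p.2, -β * p.1 + d * p.2)
  left_inv p := by
    have h' : (α : ℝ) * d - β * γ = 1 := by exact_mod_cast h
    ext <;> simp only
    · linear_combination p.1 * h'
    · linear_combination p.2 * h'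
  right_inv p := by
    have h' : (α : ℝ) * d - β * γ = 1 := by exact_mod_cast h
    ext <;> simp only
    · linear_combination p.1 * h'
    · linear_combination p.2 * h'
  continuous_toFun := by fun_prop
  continuous_invFun := by fun_prop

/-- The restriction of `planeHomeo` to `ℤ²`. -/
def latticeEquiv {α β γ d : ℤ} (h : α * d - β * γ = 1) : ℤ × ℤ ≃ ℤ × ℤ where
  toFun p := (d * p.1 + γ * p.2, β * p.1 + α * p.2)
  invFun p := (α * p.1 - γ * p.2, -β * p.1 + d * p.2)
  left_inv p := by
    ext <;> simp only
    · linear_combination p.1 * h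
    · linear_combination p.2 * h
  right_inv p := by
    ext <;> simp only
    · linear_combination p.1 * h
    · linear_combination p.2 * h

lemma torusTest_apply (k n : ℤ) (p : ℝ × ℝ) :
    torusTest k n p = e (-(k * p.1 + n * p.2)) * (cutoff p.1 * cutoff p.2) := rfl

lemma hasSum_cutoff_mul_cutoff (u v : ℝ) :
    HasSum (fun m : ℤ × ℤ => cutoff (u + m.1) * cutoff (v + m.2)) 1 := by
  have h := (cutoff_hasSum u).mul (cutoff_hasSum v)
    (summable_mul_of_summable_norm (f := fun m : ℤ => cutoff (u + m))
      (g := fun m : ℤ => cutoff (v + m)) (cutoff_hasSum u).summable.norm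
      (cutoff_hasSum v).summable.norm)
  rwa [mul_one] at h

lemma abs_le_of_cutoff_add_ne_zero {R x t : ℝ} (hx : |x| ≤ R) (h : cutoff (x + t) ≠ 0) :
    |t| ≤ 1 + R := by
  have h1 := abs_le_of_cutoff_ne_zero h
  have h2 := abs_sub (x + t) x
  rw [add_sub_cancel_left] at h2
  linarith

section Family

variable {μ : ℂ} {η : ZMod 2} {B : Test (ℝ × ℝ) → SL2Functional μ η}

/-- The equivariance of the Fourier components under `SL(2, ℤ)`. -/
lemma IsEquivariantFamily.torusTest_eq (hB : IsEquivariantFamily B) {α β γ d : ℤ}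
    (h : α * d - β * γ = 1) (n k : ℤ) (F F' : SL2Smooth (-μ) η)
    (hF : ∀ v, F'.1 v = F.1 (act2 !![(α : ℝ), (β : ℝ); (γ : ℝ), (d : ℝ)] v)) :
    B (torusTest k n) F = B (torusTest (n * β + k * d) (n * α + k * γ)) F' := by
  have hsm : ContDiff ℝ ∞ (planeHomeo h) := by
    change ContDiff ℝ ∞ fun p : ℝ × ℝ => ((d : ℝ) * p.1 + γ * p.2, (β : ℝ) * p.1 + α * p.2)
    fun_prop
  rw [hB.sl2 α β γ d h (torusTest k n) ((torusTest k n).compHomeo (planeHomeo h) hsm)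
    (fun _ => rfl) F F' hF]
  let ℓ : ℤ × ℤ →+ ℝ × ℝ := AddMonoidHom.prodMap (Int.castAddHom ℝ) (Int.castAddHom ℝ)
  let T : Test (ℝ × ℝ) →+ ℂ := AddMonoidHom.mk' (fun Φ => B Φ F') fun Φ Φ' => hB.add Φ Φ' F'
  refine eq_of_periodization ℓ T (fun m Φ => hB.shift m.1 m.2 Φ F')
    (fun p => cutoff p.1 * cutoff p.2) ?_ (fun p => hasSum_cutoff_mul_cutoff p.1 p.2) (fun R => ?_)
    _ _ (fun p => e (-((n * β + k * d : ℤ) * p.1 + (n * α + k * γ : ℤ) * p.2))) (fun p => ?_)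
    (fun p => torusTest_apply _ _ p)
  · exact (cutoff.contDiff.comp contDiff_fst).mul (cutoff.contDiff.comp contDiff_snd)
  · refine ((finite_setOf_abs_intCast_le (1 + R)).prod
      (finite_setOf_abs_intCast_le (1 + R))).subset ?_
    rintro m ⟨p, hp, hm⟩
    rw [Prod.norm_def, sup_le_iff] at hp
    exact ⟨abs_le_of_cutoff_add_ne_zero hp.1 (left_ne_zero_of_mul hm),
      abs_le_of_cutoff_add_ne_zero hp.2 (right_ne_zero_of_mul hm)⟩
  · have h1 := (latticeEquiv h).hasSum_iff.2
      (hasSum_cutoff_mul_cutoff (planeHomeo h p).1 (planeHomeo h p).2)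
    have h2 := h1.mul_left (e (-((n * β + k * d : ℤ) * p.1 + (n * α + k * γ : ℤ) * p.2)))
    rw [mul_one] at h2
    refine (congrArg (fun f => HasSum f _) (funext fun m => ?_)).mpr h2
    change torusTest k n (planeHomeo h (p + ℓ m)) = _
    have h3 : planeHomeo h (p + ℓ m) = ((planeHomeo h p).1 + ((latticeEquiv h m).1 : ℝ),
        (planeHomeo h p).2 + ((latticeEquiv h m).2 : ℝ)) := by
      simp only [planeHomeo, latticeEquiv, ℓ]
      ext <;> simp <;> ring
    rw [h3, torusTest_apply]
    simp only [Function.comp_apply]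
    congr 1
    have h4 : ∀ (s : ℝ) (j : ℤ), e (s + j) = e s := fun s j => by rw [e_add, e_intCast, mul_one]
    rw [← h4 (-((n * β + k * d : ℤ) * p.1 + (n * α + k * γ : ℤ) * p.2))
      (-(k * (latticeEquiv h m).1 + n * (latticeEquiv h m).2))]
    congr 1
    simp only [planeHomeo, Homeomorph.homeomorph_mk_coe, Equiv.coe_fn_mk]
    push_cast
    ring

lemma pullback_apply {ν : ℂ} (A : Matrix (Fin 2) (Fin 2) ℝ) (hA : A.det ≠ 0) (F : SL2Smooth ν η)
    (v : ℝ × ℝ) : (SL2Smooth.pullback ν η A hA F).1 v = F.1 (act2 A v) := rfl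

/-- The translated components depend only on `k` modulo `n`. -/
lemma IsEquivariantFamily.psi_unip_add (hB : IsEquivariantFamily B) {n : ℤ} (hn : n ≠ 0) (k : ℤ) :
    psi μ η (unip (((k + n : ℤ) : ℝ) / n)) (B (torusTest (k + n) n)) =
      psi μ η (unip ((k : ℝ) / n)) (B (torusTest k n)) := by
  have hn' : (n : ℝ) ≠ 0 := by exact_mod_cast hn
  refine LinearMap.ext fun F => ?_
  rw [psi_apply, psi_apply, hB.torusTest_eq (α := 1) (β := 1) (γ := 0) (d := 1) (by norm_num) n k _
    (SL2Smooth.pullback (-μ) η (unip (((k + n : ℤ) : ℝ) / n)) (by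
      rw [(unip _).2]; exact one_ne_zero) F) fun v => ?_]
  · congr 2; ring_nf
  · rw [pullback_apply, pullback_apply]
    refine congrArg F.1 (Prod.ext ?_ ?_)
    · simp [act2, unip]
      field_simp
      ring
    · simp [act2, unip]

/-- The component with character `(0, q)` is conjugate to the one with character `(c q, a q)`. -/
lemma IsEquivariantFamily.eq_psi_cuspMatrix (hB : IsEquivariantFamily B) {q a abar c : ℤ}
    (hc : c ≠ 0) (hq : q ≠ 0) (ha : a * abar ≡ 1 [ZMOD c]) :
    B (torusTest q 0) = psi μ η (cuspMatrix abar c hc)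
      (psi μ η (unip (((a * q : ℤ) : ℝ) / (c * q : ℤ))) (B (torusTest (a * q) (c * q)))) := by
  obtain ⟨b, hb⟩ := ha.symm.dvd
  have hq' : (q : ℝ) ≠ 0 := by exact_mod_cast hq
  have hc' : (c : ℝ) ≠ 0 := by exact_mod_cast hc
  have hb' : (a : ℝ) * abar - 1 = c * b := by exact_mod_cast hb
  have haq : ((a * q : ℤ) : ℝ) / (c * q : ℤ) = a / c := by
    push_cast
    field_simp
  refine LinearMap.ext fun F => ?_
  rw [haq, psi_apply, psi_apply, hB.torusTest_eq (α := abar) (β := b) (γ := c) (d := a)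
    (by linear_combination hb) 0 q F
    (SL2Smooth.pullback (-μ) η (unip ((a : ℝ) / c)) (by rw [(unip _).2]; exact one_ne_zero)
      (SL2Smooth.pullback (-μ) η (cuspMatrix abar c hc) (by
        rw [(cuspMatrix abar c hc).2]; exact one_ne_zero) F)) fun v => ?_]
  · congr 2; ring_nf
  · rw [pullback_apply, pullback_apply]
    refine congrArg F.1 (Prod.ext ?_ ?_)
    · simp [act2, unip, cuspMatrix]
      field_simp
      linear_combination v.2 * hb'
    · simp [act2, unip, cuspMatrix]
      field_simp

/-- The component of the trivial character is invariant under `SL(2, ℤ)`. -/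
lemma IsEquivariantFamily.zero_eq (hB : IsEquivariantFamily B) {α β γ d : ℤ}
    (h : α * d - β * γ = 1) (F F' : SL2Smooth (-μ) η)
    (hF : ∀ v, F'.1 v = F.1 (act2 !![(α : ℝ), (β : ℝ); (γ : ℝ), (d : ℝ)] v)) :
    B (torusTest 0 0) F = B (torusTest 0 0) F' := by
  simpa using hB.torusTest_eq h 0 0 F F' hF

lemma weyl_eq_cuspMatrix : weyl = cuspMatrix 0 (-1) (by norm_num) := by
  refine Subtype.ext ?_
  simp [weyl, cuspMatrix]

lemma IsEquivariantFamily.zero_eq_psi_weyl (hB : IsEquivariantFamily B) :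
    B (torusTest 0 0) = psi μ η weyl (B (torusTest 0 0)) := by
  refine LinearMap.ext fun F => ?_
  refine hB.zero_eq (α := 0) (β := 1) (γ := -1) (d := 0) (by norm_num) _ _ fun v => ?_
  rw [pullback_apply]
  simp [act2, weyl]

lemma IsEquivariantFamily.zero_eq_zero (hB : IsEquivariantFamily B) (hη : η = 1) :
    B (torusTest 0 0) = 0 := by
  refine LinearMap.ext fun F => ?_
  have h := hB.zero_eq (α := -1) (β := 0) (γ := 0) (d := -1) (by norm_num) F (-F) fun v => ?_
  · rw [map_neg] at h
    exact self_eq_neg.1 h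
  · by_cases hv : v = 0
    · subst hv
      have h0 : F.1 0 = 0 := F.2.1
      simp [act2, ← Prod.zero_eq_mk, h0]
    · have h1 := F.2.2.2 (-1) v (by norm_num) hv
      have h2 : quasiChar η (-μ - 1) (-1) = -1 := by
        subst hη
        simp [quasiChar, Real.sign_of_neg]
      rw [h2, neg_one_mul] at h1
      refine Eq.trans h1.symm (congrArg F.1 ?_)
      ext <;> simp [act2]

/-- The restriction to the line of the component with character `(0, q)` is the sum of its Fourier
series. -/
lemma IsEquivariantFamily.hasSum_restrictLine (hB : IsEquivariantFamily B) (q : ℤ) (φ : Test ℝ) :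
    HasSum (fun r : ℤ => restrictLine (B (torusTest q 0))
        (cutoff.mulSmooth (fun x => e (-(r * x))) (contDiff_e (by fun_prop))) *
      ∫ x : ℝ, e (r * x) * φ x) (restrictLine (B (torusTest q 0)) φ) := by
  obtain ⟨m, C, hC⟩ := (hB.isSL2DistVector (torusTest q 0)).exists_bound_restrictLine
  refine hasSum_fourier_of_periodic _ (fun j φ => ?_) hC φ
  rw [← restrictLine_psi_unip]
  change psi μ η (unip j) (B (torusTest q 0)) _ = B (torusTest q 0) _
  rw [psi_apply]
  have h := hB.torusTest_eq (α := 1) (β := j) (γ := 0) (d := 1) (by norm_num) 0 q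
    (lineSection (-μ) η φ) (SL2Smooth.pullback (-μ) η (unip (j : ℝ)) (by
      rw [(unip _).2]; exact one_ne_zero) (lineSection (-μ) η φ)) fun v => by
        rw [pullback_apply]
        simp [act2, unip]
  simpa using h.symm

end Family

/-! ### Invariance under integral matrices -/

lemma DistVector.IsGL3ZInvariant.apply_eq {lam : Fin 3 → ℂ} {del : Fin 3 → ZMod 2}
    {τ : DistVector lam del} (hτ : τ.IsGL3ZInvariant) (M : Matrix (Fin 3) (Fin 3) ℤ)
    (hM : M.det = 1) (f f' : SmoothVector (-lam) del)
    (h : ∀ g : Mat3, g.det ≠ 0 → f'.1 g = f.1 (M.map (Int.cast : ℤ → ℝ) * g)) :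
    τ.toLin f' = τ.toLin f := by
  rw [← hτ (Matrix.SpecialLinearGroup.toGL ⟨M, hM⟩) f]
  congr 1
  refine Subtype.ext (funext fun g => ?_)
  by_cases hg : g.det = 0
  · rw [f'.2.1 g hg]
    exact ((SmoothVector.translate _ f).2.1 g hg).symm
  · exact h g hg

lemma det_map_mul {M : Matrix (Fin 3) (Fin 3) ℤ} (hM : M.det = 1) (g : Mat3) :
    (M.map (Int.cast : ℤ → ℝ) * g).det = g.det := by
  have h := (Int.castRingHom ℝ).map_det M
  rw [hM, map_one] at h
  have h' : (M.map (Int.cast : ℤ → ℝ)).det = 1 := h.symm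
  rw [Matrix.det_mul, h', one_mul]

/-! ### The components along the upper left copy of `SL(2, ℝ)` -/

section Upper

variable {P : Params}

lemma extendUpper_apply (Φ : Test (ℝ × ℝ)) (F : SL2Smooth (-P.mu12) (P.del 2)) (g : Mat3) :
    (extendUpper P Φ F).1 g = if g.det ≠ 0 ∧ g 2 2 ≠ 0 then
      (diagChar (-P.lam) P.del (g.det / g 2 2) 1 (g 2 2))⁻¹ *
        (Φ (yCoord g, zCoord g) * F.1 (colUpper g)) else 0 := rfl

lemma extendN_apply (lam : Fin 3 → ℂ) (del : Fin 3 → ZMod 2) (ψ : Test (ℝ × ℝ × ℝ)) (g : Mat3) :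
    (extendN lam del ψ).1 g = if g.det ≠ 0 ∧ g 2 2 ≠ 0 ∧ minor g ≠ 0 then
      (diagChar lam del (g.det / minor g) (minor g / g 2 2) (g 2 2))⁻¹ *
        ψ (xCoord g, yCoord g, zCoord g) else 0 := rfl

/-- The functionals `F ↦ τ(extendUpper Φ F)`. -/
def upperFamily (τ : P.Dist) (Φ : Test (ℝ × ℝ)) : SL2Functional P.mu12 (P.del 2) :=
  τ.toLin ∘ₗ extendUpper P Φ

lemma isSL2DistVector_upperFamily (τ : P.Dist) (Φ : Test (ℝ × ℝ)) :
    IsSL2DistVector (upperFamily τ Φ) := by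
  obtain ⟨K, m, C, hK, hK0, hC⟩ := τ.continuous'
  obtain ⟨R, hR, hΦ⟩ := Φ.exists_bound
  have hent : ∀ i j, Continuous fun g : Mat3 => g i j := fun i j => (contDiff_entry i j).continuous
  set L : Set Mat3 := K ∩ {g | |g 1 2| ≤ R * |g 2 2|} ∩ {g | |g 0 2| ≤ R * |g 2 2|}
  have hL : IsCompact L :=
    (hK.inter_right (isClosed_le (hent 1 2).abs (continuous_const.mul (hent 2 2).abs))).inter_right
      (isClosed_le (hent 0 2).abs (continuous_const.mul (hent 2 2).abs))
  set Ω : Set Mat3 := {g | g.det ≠ 0 ∧ g 2 2 ≠ 0}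
  have hΩ : IsOpen Ω :=
    (isOpen_ne.preimage contDiff_det3.continuous).inter (isOpen_ne.preimage (hent 2 2))
  have hLΩ : L ⊆ Ω := by
    rintro g ⟨⟨hg, h1⟩, h2⟩
    refine ⟨hK0 hg, fun h0 => hK0 hg ?_⟩
    simp only [Set.mem_ofPred_eq, h0, abs_zero, mul_zero, abs_nonpos_iff] at h1 h2
    rw [Matrix.det_fin_three, h0, h1, h2]
    ring
  have hentd := fun i j (g : Mat3) => (contDiff_entry i j).contDiffAt (x := g)
  have hcol : ContDiffOn ℝ ∞ colUpper Ω := fun g hg => by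
    obtain ⟨hd, h2⟩ := hg
    exact (((hentd 0 1 g).sub ((hentd 0 2 g).mul ((hentd 2 1 g).div (hentd 2 2 g) h2))).prodMk
      ((hentd 1 1 g).sub
        ((hentd 1 2 g).mul ((hentd 2 1 g).div (hentd 2 2 g) h2)))).contDiffWithinAt
  obtain ⟨C', hC'0, hC'⟩ := exists_bound_of_eventuallyEq K hΩ (isOpen_ne (x := (0 : ℝ × ℝ)))
    (u := fun g => (diagChar (-P.lam) P.del (g.det / g 2 2) 1 (g 2 2))⁻¹ *
      Φ (yCoord g, zCoord g)) (c := colUpper) (fun g hg => by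
        obtain ⟨hd, h2⟩ := hg
        refine (ContDiffAt.mul (contDiffAt_diagChar_inv _ _
          (contDiff_det3.contDiffAt.div (hentd 2 2 g) h2) contDiffAt_const (hentd 2 2 g)
          (div_ne_zero hd h2) one_ne_zero h2) ?_).contDiffWithinAt
        exact Φ.contDiff.contDiffAt.comp g ((contDiffAt_yCoord h2).prodMk (contDiffAt_zCoord h2)))
    hcol (fun g hg => colUpper_ne_zero hg.1 hg.2) hL hLΩ m
  refine ⟨colUpper '' L, m, C * C', hL.image_of_continuousOn (hcol.continuousOn.mono hLΩ), ?_, fun F B hB hF => ?_⟩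
  · rintro _ ⟨g, hg, rfl⟩
    exact colUpper_ne_zero (hLΩ hg).1 (hLΩ hg).2
  · rw [mul_assoc]
    refine hC _ _ (mul_nonneg hC'0 hB) (hC' F.1 _ F.2.2.1 (fun g hg => ?_) (fun g hg hgL => ?_)
      B hB hF)
    · filter_upwards [hΩ.mem_nhds (hLΩ hg)] with h hh
      have hh' : h.det ≠ 0 ∧ h 2 2 ≠ 0 := hh
      rw [extendUpper_apply, if_pos hh', mul_assoc]
    · have hlarge : ∀ᶠ h : Mat3 in 𝓝 g, R * |h 2 2| < |h 1 2| ∨ R * |h 2 2| < |h 0 2| := by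
        by_cases h1 : |g 1 2| ≤ R * |g 2 2|
        · have h2 : R * |g 2 2| < |g 0 2| := not_le.1 fun h2 => hgL ⟨⟨hg, h1⟩, h2⟩
          exact (ContinuousAt.eventually_lt (continuous_const.mul (hent 2 2).abs).continuousAt
            (hent 0 2).abs.continuousAt h2).mono fun _ => Or.inr
        · exact (ContinuousAt.eventually_lt (continuous_const.mul (hent 2 2).abs).continuousAt
            (hent 1 2).abs.continuousAt (not_le.1 h1)).mono fun _ => Or.inl
      filter_upwards [hlarge] with h hh
      rw [extendUpper_apply]
      split_ifs with h0
      · have hz : Φ (yCoord h, zCoord h) = 0 := by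
          by_contra hne
          have h1 := hΦ _ hne
          rw [Prod.norm_def, sup_le_iff, Real.norm_eq_abs, Real.norm_eq_abs, yCoord, zCoord,
            abs_div, abs_div, div_le_iff₀ (abs_pos.2 h0.2), div_le_iff₀ (abs_pos.2 h0.2)] at h1
          rcases hh with hh | hh
          · exact absurd h1.1 (not_le.2 hh)
          · exact absurd h1.2 (not_le.2 hh)
        simp [hz]
      · rfl

/-- The components along the upper left copy of `SL(2, ℝ)` form an equivariant family. -/
lemma isEquivariantFamily_upper (τ : P.Dist) (hτ : τ.IsGL3ZInvariant) :
    IsEquivariantFamily (upperFamily τ) where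
  add Φ Φ' F := by
    change τ.toLin _ = τ.toLin _ + τ.toLin _
    rw [← map_add]
    congr 1
    refine Subtype.ext (funext fun g => ?_)
    change (extendUpper P (Φ + Φ') F).1 g = (extendUpper P Φ F).1 g + (extendUpper P Φ' F).1 g
    simp only [extendUpper_apply]
    split_ifs
    · rw [← mul_add, ← add_mul]
      rfl
    · rw [add_zero]
  shift m l Φ F := by
    have hM : (!![1, 0, l; 0, 1, m; 0, 0, 1] : Matrix (Fin 3) (Fin 3) ℤ).det = 1 := by
      simp [Matrix.det_fin_three]
    refine hτ.apply_eq _ hM _ _ fun g _ => ?_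
    rw [extendUpper_apply, extendUpper_apply, det_map_mul hM]
    set h := (!![1, 0, l; 0, 1, m; 0, 0, 1] : Matrix (Fin 3) (Fin 3) ℤ).map
      (Int.cast : ℤ → ℝ) * g with hh
    have e0 : ∀ j, h 0 j = g 0 j + l * g 2 j := fun j => by
      simp [hh, Matrix.mul_apply, Fin.sum_univ_three]
    have e1 : ∀ j, h 1 j = g 1 j + m * g 2 j := fun j => by
      simp [hh, Matrix.mul_apply, Fin.sum_univ_three]
    have e2 : ∀ j, h 2 j = g 2 j := fun j => by
      simp [hh, Matrix.mul_apply, Fin.sum_univ_three]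
    rw [e2 2]
    split_ifs with h0
    · have h2 := h0.2
      rw [Test.shift_apply]
      congr 3
      · refine Prod.ext ?_ ?_
        · simp only [yCoord, e1, e2, Prod.fst_add]
          field_simp
        · simp only [zCoord, e0, e2, Prod.snd_add]
          field_simp
      · refine congrArg F.1 (Prod.ext ?_ ?_)
        · simp only [colUpper, e0, e2]
          field_simp
          ring
        · simp only [colUpper, e1, e2]
          field_simp
          ring
    · rfl
  sl2 α β γ d hA Φ Φ' hΦ F F' hF := by
    symm
    have hM : (!![α, β, 0; γ, d, 0; 0, 0, 1] : Matrix (Fin 3) (Fin 3) ℤ).det = 1 := by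
      simp [Matrix.det_fin_three, hA]
    refine hτ.apply_eq _ hM _ _ fun g _ => ?_
    rw [extendUpper_apply, extendUpper_apply, det_map_mul hM]
    set h := (!![α, β, 0; γ, d, 0; 0, 0, 1] : Matrix (Fin 3) (Fin 3) ℤ).map
      (Int.cast : ℤ → ℝ) * g with hh
    have e0 : ∀ j, h 0 j = α * g 0 j + β * g 1 j := fun j => by
      simp [hh, Matrix.mul_apply, Fin.sum_univ_three]
    have e1 : ∀ j, h 1 j = γ * g 0 j + d * g 1 j := fun j => by
      simp [hh, Matrix.mul_apply, Fin.sum_univ_three]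
    have e2 : ∀ j, h 2 j = g 2 j := fun j => by
      simp [hh, Matrix.mul_apply, Fin.sum_univ_three]
    rw [e2 2]
    split_ifs with h0
    · have h2 := h0.2
      rw [hΦ, hF]
      congr 3
      · refine Prod.ext ?_ ?_
        · simp only [yCoord, zCoord, e1, e2]
          field_simp
          ring
        · simp only [yCoord, zCoord, e0, e2]
          field_simp
          ring
      · refine congrArg F.1 (Prod.ext ?_ ?_)
        · simp only [colUpper, e0, e2, act2]
          simp
          field_simp
          ring
        · simp only [colUpper, e1, e2, act2]
          simp
          field_simp
          ring
    · rfl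
  isSL2DistVector := isSL2DistVector_upperFamily τ

lemma restrictLine_upperFamily (τ : P.Dist) (Φ : Test (ℝ × ℝ)) (φ : Test ℝ) :
    restrictLine (upperFamily τ Φ) φ = restrictN τ (Test.tensor φ Φ) := by
  change τ.toLin _ = τ.toLin _
  congr 1
  refine Subtype.ext (funext fun g => ?_)
  rw [extendUpper_apply, extendN_apply, lineSection_apply]
  by_cases hg : g.det ≠ 0 ∧ g 2 2 ≠ 0
  · have h2 := hg.2
    have hc2 : (colUpper g).2 = minor g / g 2 2 := by
      simp only [colUpper, minor]
      field_simp
    rw [if_pos hg]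
    by_cases hm : minor g = 0
    · rw [if_pos (by rw [hc2, hm, zero_div]), if_neg (fun h => h.2.2 hm), mul_zero, mul_zero]
    · have hq : minor g / g 2 2 ≠ 0 := div_ne_zero hm h2
      have hx : (colUpper g).1 / (colUpper g).2 = xCoord g := by
        rw [hc2]
        simp only [colUpper, xCoord]
        field_simp
      rw [hc2, if_neg hq, if_pos ⟨hg.1, h2, hm⟩, ← hc2, hx, hc2]
      change _ * (Φ (yCoord g, zCoord g) * (_ * φ (xCoord g))) =
        _ * (φ (xCoord g) * Φ (yCoord g, zCoord g))
      have key : (diagChar (-P.lam) P.del (g.det / g 2 2) 1 (g 2 2))⁻¹ *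
          quasiChar (P.del 2) (-P.mu12 - 1) (minor g / g 2 2) =
          (diagChar (-P.lam) P.del (g.det / minor g) (minor g / g 2 2) (g 2 2))⁻¹ := by
        rw [diagChar_eq _ _ (div_ne_zero hg.1 h2) h2, diagChar_eq _ _ (div_ne_zero hg.1 hm) h2,
          show g.det / g 2 2 = g.det / minor g * (minor g / g 2 2) by field_simp, quasiChar_one,
          quasiChar_mul]
        have hsplit : quasiChar (P.del 0) ((-P.lam) 0 - 1) (minor g / g 2 2) =
            quasiChar (P.del 2) (-P.mu12 - 1) (minor g / g 2 2) *
              quasiChar (P.del 1) ((-P.lam) 1) (minor g / g 2 2) := by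
          rw [← quasiChar_add _ _ _ _ hq, Params.mu12]
          have : ∀ a b c : ZMod 2, a + b = c → a = c + b := by decide
          rw [← this _ _ _ P.del01]
          congr 1
          simp only [Pi.neg_apply]
          ring
        rw [hsplit]
        have n2 := quasiChar_ne_zero (P.del 2) (-P.mu12 - 1) hq
        simp only [mul_inv]
        field_simp
      rw [← key]
      ring
  · rw [if_neg hg, if_neg fun h => hg ⟨h.1, h.2.1⟩]

end Upper

/-! ### The components along the lower right copy of `SL(2, ℝ)` -/

section Lower

variable {P : Params}

lemma extendLower_apply (Φ : Test (ℝ × ℝ)) (F : SL2Smooth (-P.mu23) (P.del 0)) (g : Mat3) :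
    (extendLower P Φ F).1 g = if g.det ≠ 0 ∧ minor g ≠ 0 then
      (diagChar (-P.lam) P.del (g.det / minor g) (minor g) 1)⁻¹ *
        (Φ (xCoord g, wCoord g) * F.1 (colLower g)) else 0 := rfl

/-- The functionals `F ↦ τ(extendLower Φ F)`. -/
def lowerFamily (τ : P.Dist) (Φ : Test (ℝ × ℝ)) : SL2Functional P.mu23 (P.del 0) :=
  τ.toLin ∘ₗ extendLower P Φ

lemma isSL2DistVector_lowerFamily (τ : P.Dist) (Φ : Test (ℝ × ℝ)) :
    IsSL2DistVector (lowerFamily τ Φ) := by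
  obtain ⟨K, m, C, hK, hK0, hC⟩ := τ.continuous'
  obtain ⟨R, hR, hΦ⟩ := Φ.exists_bound
  have hent : ∀ i j, Continuous fun g : Mat3 => g i j := fun i j => (contDiff_entry i j).continuous
  have hx : Continuous fun g : Mat3 => |g 0 1 * g 2 2 - g 0 2 * g 2 1| :=
    (((hent 0 1).mul (hent 2 2)).sub ((hent 0 2).mul (hent 2 1))).abs
  have hw : Continuous fun g : Mat3 => |g 0 2 * g 1 1 - g 0 1 * g 1 2| :=
    (((hent 0 2).mul (hent 1 1)).sub ((hent 0 1).mul (hent 1 2))).abs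
  have hm : Continuous fun g : Mat3 => R * |minor g| :=
    continuous_const.mul contDiff_minor.continuous.abs
  set L : Set Mat3 := K ∩ {g | |g 0 1 * g 2 2 - g 0 2 * g 2 1| ≤ R * |minor g|} ∩
    {g | |g 0 2 * g 1 1 - g 0 1 * g 1 2| ≤ R * |minor g|}
  have hL : IsCompact L := (hK.inter_right (isClosed_le hx hm)).inter_right (isClosed_le hw hm)
  set Ω : Set Mat3 := {g | g.det ≠ 0 ∧ minor g ≠ 0}
  have hΩ : IsOpen Ω := (isOpen_ne.preimage contDiff_det3.continuous).inter
    (isOpen_ne.preimage contDiff_minor.continuous)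
  have hLΩ : L ⊆ Ω := by
    rintro g ⟨⟨hg, h1⟩, h2⟩
    refine ⟨hK0 hg, fun h0 => hK0 hg ?_⟩
    simp only [Set.mem_ofPred_eq, h0, abs_zero, mul_zero, abs_nonpos_iff] at h1 h2
    rw [minor] at h0
    rw [Matrix.det_fin_three]
    linear_combination g 0 0 * h0 - g 1 0 * h1 - g 2 0 * h2
  have hcol : ContDiff ℝ ∞ colLower := (contDiff_entry 1 2).prodMk (contDiff_entry 2 2)
  obtain ⟨C', hC'0, hC'⟩ := exists_bound_of_eventuallyEq K hΩ (isOpen_ne (x := (0 : ℝ × ℝ)))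
    (u := fun g => (diagChar (-P.lam) P.del (g.det / minor g) (minor g) 1)⁻¹ *
      Φ (xCoord g, wCoord g)) (c := colLower) (fun g hg => by
        obtain ⟨hd, h2⟩ := hg
        refine (ContDiffAt.mul (contDiffAt_diagChar_inv _ _
          (contDiff_det3.contDiffAt.div contDiff_minor.contDiffAt h2) contDiff_minor.contDiffAt
          contDiffAt_const (div_ne_zero hd h2) h2 one_ne_zero) ?_).contDiffWithinAt
        exact Φ.contDiff.contDiffAt.comp g ((contDiffAt_xCoord h2).prodMk (contDiffAt_wCoord h2)))
    hcol.contDiffOn (fun g hg => colLower_ne_zero hg.2) hL hLΩ m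
  refine ⟨colLower '' L, m, C * C', hL.image hcol.continuous, ?_, fun F B hB hF => ?_⟩
  · rintro _ ⟨g, hg, rfl⟩
    exact colLower_ne_zero (hLΩ hg).2
  · rw [mul_assoc]
    refine hC _ _ (mul_nonneg hC'0 hB) (hC' F.1 _ F.2.2.1 (fun g hg => ?_) (fun g hg hgL => ?_)
      B hB hF)
    · filter_upwards [hΩ.mem_nhds (hLΩ hg)] with h hh
      have hh' : h.det ≠ 0 ∧ minor h ≠ 0 := hh
      rw [extendLower_apply, if_pos hh', mul_assoc]
    · have hlarge : ∀ᶠ h : Mat3 in 𝓝 g, R * |minor h| < |h 0 1 * h 2 2 - h 0 2 * h 2 1| ∨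
          R * |minor h| < |h 0 2 * h 1 1 - h 0 1 * h 1 2| := by
        by_cases h1 : |g 0 1 * g 2 2 - g 0 2 * g 2 1| ≤ R * |minor g|
        · have h2 : R * |minor g| < |g 0 2 * g 1 1 - g 0 1 * g 1 2| :=
            not_le.1 fun h2 => hgL ⟨⟨hg, h1⟩, h2⟩
          exact (ContinuousAt.eventually_lt hm.continuousAt hw.continuousAt h2).mono
            fun _ => Or.inr
        · exact (ContinuousAt.eventually_lt hm.continuousAt hx.continuousAt
            (not_le.1 h1)).mono fun _ => Or.inl
      filter_upwards [hlarge] with h hh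
      rw [extendLower_apply]
      split_ifs with h0
      · have hz : Φ (xCoord h, wCoord h) = 0 := by
          by_contra hne
          have h1 := hΦ _ hne
          rw [Prod.norm_def, sup_le_iff, Real.norm_eq_abs, Real.norm_eq_abs, xCoord, wCoord,
            abs_div, abs_div, div_le_iff₀ (abs_pos.2 h0.2), div_le_iff₀ (abs_pos.2 h0.2)] at h1
          rcases hh with hh | hh
          · exact absurd h1.1 (not_le.2 hh)
          · exact absurd h1.2 (not_le.2 hh)
        simp [hz]
      · rfl

lemma reflect_apply {μ : ℂ} {η : ZMod 2} (S : SL2Functional μ η) (F : SL2Smooth (-μ) η) :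
    reflect μ η S F = S (SL2Smooth.pullback (-μ) η !![-1, 0; 0, 1] (by simp) F) := rfl

lemma reflect_reflect {μ : ℂ} {η : ZMod 2} (S : SL2Functional μ η) :
    reflect μ η (reflect μ η S) = S := by
  refine LinearMap.ext fun F => ?_
  rw [reflect_apply, reflect_apply]
  congr 1
  refine Subtype.ext (funext fun v => ?_)
  rw [pullback_apply, pullback_apply]
  refine congrArg F.1 (Prod.ext ?_ ?_) <;> simp [act2]

/-- After the reflection `x ↦ -x`, the components along the lower right copy of `SL(2, ℝ)` form an
equivariant family: the block `A ∈ SL(2, ℤ)` acts on `(x, w)` through its inverse, and the reflection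
turns this into the action on `(y, z)` of the upper left block. -/
lemma isEquivariantFamily_lower (τ : P.Dist) (hτ : τ.IsGL3ZInvariant) :
    IsEquivariantFamily fun Φ => reflect P.mu23 (P.del 0) (lowerFamily τ Φ) where
  add Φ Φ' F := by
    change τ.toLin _ = τ.toLin _ + τ.toLin _
    rw [← map_add]
    congr 1
    refine Subtype.ext (funext fun g => ?_)
    set F' := SL2Smooth.pullback (-P.mu23) (P.del 0) !![-1, 0; 0, 1] (by simp) F
    change (extendLower P (Φ + Φ') F').1 g = (extendLower P Φ F').1 g + (extendLower P Φ' F').1 g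
    simp only [extendLower_apply]
    split_ifs
    · rw [← mul_add, ← add_mul]
      rfl
    · rw [add_zero]
  shift m l Φ F := by
    have hM : (!![1, m, l; 0, 1, 0; 0, 0, 1] : Matrix (Fin 3) (Fin 3) ℤ).det = 1 := by
      simp [Matrix.det_fin_three]
    refine hτ.apply_eq _ hM _ _ fun g _ => ?_
    rw [extendLower_apply, extendLower_apply, det_map_mul hM]
    set h := (!![1, m, l; 0, 1, 0; 0, 0, 1] : Matrix (Fin 3) (Fin 3) ℤ).map
      (Int.cast : ℤ → ℝ) * g with hh
    have e0 : ∀ j, h 0 j = g 0 j + m * g 1 j + l * g 2 j := fun j => by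
      simp [hh, Matrix.mul_apply, Fin.sum_univ_three]
    have e1 : ∀ j, h 1 j = g 1 j := fun j => by
      simp [hh, Matrix.mul_apply, Fin.sum_univ_three]
    have e2 : ∀ j, h 2 j = g 2 j := fun j => by
      simp [hh, Matrix.mul_apply, Fin.sum_univ_three]
    have em : minor h = minor g := by simp only [minor, e1, e2]
    have ec : colLower h = colLower g := by simp only [colLower, e1, e2]
    rw [em, ec]
    split_ifs with h0
    · have h2 := h0.2
      rw [Test.shift_apply]
      congr 3
      refine Prod.ext ?_ ?_
      · simp only [xCoord, em, e0, e2, Prod.fst_add]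
        field_simp
        rw [minor]
        ring
      · simp only [wCoord, em, e0, e1, Prod.snd_add]
        field_simp
        rw [minor]
        ring
    · rfl
  sl2 α β γ d hA Φ Φ' hΦ F F' hF := by
    symm
    have hA' : (α : ℝ) * d - β * γ = 1 := by exact_mod_cast hA
    -- The block is the conjugate of `(α, β; γ, d)` by the reflection.
    have hM : (!![1, 0, 0; 0, α, -β; 0, -γ, d] : Matrix (Fin 3) (Fin 3) ℤ).det = 1 := by
      simp [Matrix.det_fin_three, hA]
    refine hτ.apply_eq _ hM _ _ fun g _ => ?_
    rw [extendLower_apply, extendLower_apply, det_map_mul hM]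
    set h := (!![1, 0, 0; 0, α, -β; 0, -γ, d] : Matrix (Fin 3) (Fin 3) ℤ).map
      (Int.cast : ℤ → ℝ) * g with hh
    have e0 : ∀ j, h 0 j = g 0 j := fun j => by
      simp [hh, Matrix.mul_apply, Fin.sum_univ_three]
    have e1 : ∀ j, h 1 j = α * g 1 j - β * g 2 j := fun j => by
      simp [hh, Matrix.mul_apply, Fin.sum_univ_three, sub_eq_add_neg]
    have e2 : ∀ j, h 2 j = -γ * g 1 j + d * g 2 j := fun j => by
      simp [hh, Matrix.mul_apply, Fin.sum_univ_three]
    have em : minor h = minor g := by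
      simp only [minor, e1, e2]
      linear_combination (g 1 1 * g 2 2 - g 1 2 * g 2 1) * hA'
    rw [em]
    split_ifs with h0
    · have h2 := h0.2
      rw [hΦ, pullback_apply, hF, pullback_apply]
      congr 3
      · refine Prod.ext ?_ ?_
        · simp only [xCoord, wCoord, em, e0, e2]
          field_simp
          ring
        · simp only [xCoord, wCoord, em, e0, e1]
          field_simp
          ring
      · refine congrArg F.1 (Prod.ext ?_ ?_)
        · simp [colLower, e1, act2]
          ring
        · simp [colLower, e2, act2]
    · rfl
  isSL2DistVector Φ := (isSL2DistVector_lowerFamily τ Φ).reflect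

lemma contDiff_coordChange : ContDiff ℝ ∞ coordChange := by
  change ContDiff ℝ ∞ (fun p : ℝ × ℝ × ℝ => (p.2.1, p.1, p.2.2 - p.1 * p.2.1))
  fun_prop

lemma restrictLine_lowerFamily (τ : P.Dist) (Φ : Test (ℝ × ℝ)) (φ : Test ℝ) :
    restrictLine (lowerFamily τ Φ) φ =
      restrictN τ ((Test.tensor φ Φ).compHomeo coordChange contDiff_coordChange) := by
  change τ.toLin _ = τ.toLin _
  congr 1
  refine Subtype.ext (funext fun g => ?_)
  rw [extendLower_apply, extendN_apply, lineSection_apply]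
  by_cases hg : g.det ≠ 0 ∧ minor g ≠ 0
  · have hm := hg.2
    rw [if_pos hg]
    by_cases h2 : g 2 2 = 0
    · rw [if_pos (show (colLower g).2 = 0 from h2), if_neg (fun h => h.2.1 h2), mul_zero, mul_zero]
    · have hw : zCoord g - xCoord g * yCoord g = wCoord g := by
        simp only [zCoord, xCoord, yCoord, wCoord]
        field_simp
        rw [minor]
        ring
      rw [if_neg (show ¬ (colLower g).2 = 0 from h2), if_pos ⟨hg.1, h2, hm⟩]
      change _ * (Φ (xCoord g, wCoord g) * (quasiChar (P.del 0) (-P.mu23 - 1) (g 2 2) *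
        φ (yCoord g))) = _ * (φ (yCoord g) * Φ (xCoord g, zCoord g - xCoord g * yCoord g))
      rw [hw]
      have key : (diagChar (-P.lam) P.del (g.det / minor g) (minor g) 1)⁻¹ *
          quasiChar (P.del 0) (-P.mu23 - 1) (g 2 2) =
          (diagChar (-P.lam) P.del (g.det / minor g) (minor g / g 2 2) (g 2 2))⁻¹ := by
        rw [diagChar_eq _ _ (div_ne_zero hg.1 hm) one_ne_zero,
          diagChar_eq _ _ (div_ne_zero hg.1 hm) h2, quasiChar_one]
        have hmul : quasiChar (P.del 1) ((-P.lam) 1) (minor g) =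
            quasiChar (P.del 1) ((-P.lam) 1) (minor g / g 2 2) *
              quasiChar (P.del 1) ((-P.lam) 1) (g 2 2) := by
          rw [← quasiChar_mul, div_mul_cancel₀ _ h2]
        have hsplit : quasiChar (P.del 1) ((-P.lam) 1) (g 2 2) =
            quasiChar (P.del 0) (-P.mu23 - 1) (g 2 2) *
              quasiChar (P.del 2) ((-P.lam) 2 + 1) (g 2 2) := by
          rw [← quasiChar_add _ _ _ _ h2, Params.mu23]
          have : ∀ a b c : ZMod 2, a + b = c → a = c + b := by decide
          rw [← this _ _ _ P.del12]
          congr 1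
          simp only [Pi.neg_apply]
          ring
        rw [hmul, hsplit]
        have n2 := quasiChar_ne_zero (P.del 0) (-P.mu23 - 1) h2
        simp only [mul_inv]
        field_simp
      rw [← key]
      ring
  · rw [if_neg hg, if_neg fun h => hg ⟨h.1, h.2.2⟩]

/-- The abelian coefficient `c_{q,s}` can be computed with the cutoff in `w = z - x y` in place of the
one in `z`. -/
lemma restrictLine_lowerFamily_torusTest (τ : P.Dist) (hτ : τ.IsGL3ZInvariant) (q s : ℤ) :
    restrictLine (lowerFamily τ (torusTest q 0))
      (cutoff.mulSmooth (fun x => e (-(s * x))) (contDiff_e (by fun_prop))) =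
        abelianCoeff τ q s := by
  rw [restrictLine_lowerFamily]
  let ℓ : ℤ →+ ℝ × ℝ × ℝ := AddMonoidHom.mk' (fun m => (0, 0, (m : ℝ))) fun a b => by simp
  refine eq_of_periodization ℓ (restrictN τ).toAddMonoidHom (fun m ψ => ?_)
    (fun p => cutoff p.2.2) (cutoff.contDiff.comp (contDiff_snd.comp contDiff_snd))
    (fun p => cutoff_hasSum p.2.2) (fun R => ?_) _ _
    (fun p => e (-(s * p.2.1)) * cutoff p.2.1 * (e (-(q * p.1)) * cutoff p.1)) (fun p => ?_)
    fun p => ?_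
  · have hM : (!![1, 0, m; 0, 1, 0; 0, 0, 1] : Matrix (Fin 3) (Fin 3) ℤ).det = 1 := by
      simp [Matrix.det_fin_three]
    refine hτ.apply_eq _ hM (extendN (-P.lam) P.del ψ) (extendN (-P.lam) P.del (ψ.shift (ℓ m)))
      fun g _ => ?_
    rw [extendN_apply, extendN_apply, det_map_mul hM]
    set h := (!![1, 0, m; 0, 1, 0; 0, 0, 1] : Matrix (Fin 3) (Fin 3) ℤ).map
      (Int.cast : ℤ → ℝ) * g with hh
    have e0 : ∀ j, h 0 j = g 0 j + m * g 2 j := fun j => by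
      simp [hh, Matrix.mul_apply, Fin.sum_univ_three]
    have e1 : ∀ j, h 1 j = g 1 j := fun j => by
      simp [hh, Matrix.mul_apply, Fin.sum_univ_three]
    have e2 : ∀ j, h 2 j = g 2 j := fun j => by
      simp [hh, Matrix.mul_apply, Fin.sum_univ_three]
    have em : minor h = minor g := by simp only [minor, e1, e2]
    rw [em, e2 2]
    split_ifs with h0
    · have h2 := h0.2.1
      rw [Test.shift_apply]
      congr 2
      refine Prod.ext ?_ (Prod.ext ?_ ?_)
      · simp only [xCoord, em, e0, e2, ℓ, AddMonoidHom.mk'_apply, Prod.fst_add, add_zero]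
        ring
      · simp only [yCoord, e1, e2, ℓ, AddMonoidHom.mk'_apply, Prod.fst_add, Prod.snd_add, add_zero]
      · simp only [zCoord, e0, e2, ℓ, AddMonoidHom.mk'_apply, Prod.snd_add]
        field_simp
    · rfl
  · refine (finite_setOf_abs_intCast_le (1 + R)).subset ?_
    rintro m ⟨p, hp, hm⟩
    rw [Prod.norm_def, sup_le_iff, Prod.norm_def, sup_le_iff] at hp
    exact abs_le_of_cutoff_add_ne_zero hp.2.2 hm
  · have h := (cutoff_hasSum (p.2.2 - p.1 * p.2.1)).mul_left
      (e (-(s * p.2.1)) * cutoff p.2.1 * (e (-(q * p.1)) * cutoff p.1))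
    rw [mul_one] at h
    refine (congrArg (fun f => HasSum f _) (funext fun m => ?_)).mpr h
    change e (-(s * (p.2.1 + 0))) * cutoff (p.2.1 + 0) * (e (-(q * (p.1 + 0) + (0 : ℤ) *
      (p.2.2 + m - (p.1 + 0) * (p.2.1 + 0)))) * (cutoff (p.1 + 0) *
        cutoff (p.2.2 + m - (p.1 + 0) * (p.2.1 + 0)))) = _
    rw [add_zero, add_zero, Int.cast_zero, zero_mul, add_zero,
      show p.2.2 + m - p.1 * p.2.1 = p.2.2 - p.1 * p.2.1 + m by ring]
    ring
  · change e (-(q * p.1)) * cutoff p.1 * (e (-(s * p.2.1 + (0 : ℤ) * p.2.2)) *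
      (cutoff p.2.1 * cutoff p.2.2)) = _
    rw [Int.cast_zero, zero_mul, add_zero]
    ring

/-- The reflection `x ↦ φ(-x)` of a test function. -/
def Test.neg (φ : Test ℝ) : Test ℝ := φ.compHomeo (Homeomorph.neg ℝ) contDiff_neg

lemma restrictLine_reflect {μ : ℂ} {η : ZMod 2} (S : SL2Functional μ η) (φ : Test ℝ) :
    restrictLine (reflect μ η S) φ = restrictLine S φ.neg := by
  change S _ = S _
  congr 1
  refine Subtype.ext (funext fun v => ?_)
  rw [pullback_apply, lineSection_apply, lineSection_apply]
  simp only [act2, Matrix.of_apply, Matrix.cons_val', Matrix.cons_val_zero, Matrix.cons_val_one,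
    Matrix.cons_val_fin_one, one_mul, zero_mul, zero_add, add_zero, neg_mul]
  split_ifs
  · rfl
  · rw [neg_div]
    rfl

end Lower

/-! ### The components of an invariant distribution vector -/

section Components

variable {P : Params} {τ : P.Dist}

lemma sigmaVec_eq (τ : P.Dist) (n k : ℤ) :
    sigmaVec τ n k = psi _ _ (unip ((k : ℝ) / n)) (upperFamily τ (torusTest k n)) := rfl

lemma rhoVec_eq (τ : P.Dist) (n k : ℤ) : rhoVec τ n k =
    psi _ _ (unip ((k : ℝ) / n)) (reflect _ _ (lowerFamily τ (torusTest k n))) := rfl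

lemma restrictLine_sigmaVec (τ : P.Dist) (n k : ℤ) : restrictLine (sigmaVec τ n k) = sigma τ n k := by
  refine LinearMap.ext fun φ => ?_
  rw [sigmaVec_eq, restrictLine_psi_unip, restrictLine_upperFamily]
  rfl

lemma restrictLine_rhoVec (τ : P.Dist) (n k : ℤ) : restrictLine (rhoVec τ n k) = rho τ n k := by
  refine LinearMap.ext fun φ => ?_
  rw [rhoVec_eq, restrictLine_psi_unip, restrictLine_reflect, restrictLine_lowerFamily]
  change restrictN τ _ = restrictN τ (rhoTest n k φ)
  congr 1
  refine TestFunction.ext fun p => ?_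
  change φ (-p.2.1 + (k : ℝ) / n) * _ = φ ((k : ℝ) / n - p.2.1) * _
  rw [neg_add_eq_sub]

/-- The row series `∑ c_{r,q} e(r x)`. -/
lemma hasSum_rowVec (hτ : τ.IsGL3ZInvariant) (q : ℤ) (φ : Test ℝ) :
    HasSum (fun r : ℤ => abelianCoeff τ r q * ∫ x : ℝ, e (r * x) * φ x)
      (restrictLine (rowVec τ q) φ) := by
  have h := (isEquivariantFamily_upper τ hτ).hasSum_restrictLine q φ
  refine (congrArg (fun f => HasSum f _) (funext fun r => ?_)).mpr h
  rw [restrictLine_upperFamily]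
  rfl

/-- The column series in reflected form `∑ c_{q,-s} e(s y)`. -/
lemma hasSum_reflect_colVec (hτ : τ.IsGL3ZInvariant) (q : ℤ) (φ : Test ℝ) :
    HasSum (fun r : ℤ => abelianCoeff τ q (-r) * ∫ x : ℝ, e (r * x) * φ x)
      (restrictLine (reflect _ _ (colVec τ q)) φ) := by
  have h := (isEquivariantFamily_lower τ hτ).hasSum_restrictLine q φ
  refine (congrArg (fun f => HasSum f _) (funext fun r => ?_)).mpr h
  congr 1
  rw [restrictLine_reflect, ← restrictLine_lowerFamily_torusTest τ hτ]
  congr 1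
  refine TestFunction.ext fun x => ?_
  change e (-(((-r : ℤ) : ℝ) * x)) * cutoff x = e (-(r * -x)) * cutoff (-x)
  rw [cutoff_neg]
  push_cast
  rw [neg_mul, mul_neg]

lemma hasSum_colVec (hτ : τ.IsGL3ZInvariant) (q : ℤ) (φ : Test ℝ) :
    HasSum (fun s : ℤ => abelianCoeff τ q s * ∫ y : ℝ, e (s * y) * φ y)
      (restrictLine (colVec τ q) φ) := by
  have h := hasSum_reflect_colVec hτ q φ.neg
  rw [← restrictLine_reflect, reflect_reflect] at h
  refine (Equiv.neg ℤ).hasSum_iff.1 ?_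
  refine (congrArg (fun f => HasSum f _) (funext fun r => ?_)).mpr h
  simp only [Function.comp_apply, Equiv.neg_apply]
  congr 1
  rw [← MeasureTheory.integral_neg_eq_self]
  refine MeasureTheory.integral_congr_ae (Filter.Eventually.of_forall fun x => ?_)
  change e (((-r : ℤ) : ℝ) * -x) * φ (-x) = e (r * x) * φ (-x)
  push_cast
  rw [neg_mul_neg]

lemma rowVec_eq_psi_cuspMatrix (hτ : τ.IsGL3ZInvariant) {q a abar c : ℤ} (hc : c ≠ 0) (hq : q ≠ 0)
    (ha : a * abar ≡ 1 [ZMOD c]) :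
    rowVec τ q = psi P.mu12 (P.del 2) (cuspMatrix abar c hc) (sigmaVec τ (c * q) (a * q)) :=
  (isEquivariantFamily_upper τ hτ).eq_psi_cuspMatrix hc hq ha

lemma reflect_colVec_eq_psi_cuspMatrix (hτ : τ.IsGL3ZInvariant) {q a abar c : ℤ} (hc : c ≠ 0)
    (hq : q ≠ 0) (ha : a * abar ≡ 1 [ZMOD c]) : reflect P.mu23 (P.del 0) (colVec τ q) =
      psi P.mu23 (P.del 0) (cuspMatrix abar c hc) (rhoVec τ (c * q) (a * q)) :=
  (isEquivariantFamily_lower τ hτ).eq_psi_cuspMatrix hc hq ha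

lemma rowVec_zero_eq_psi_weyl (hτ : τ.IsGL3ZInvariant) :
    rowVec τ 0 = psi P.mu12 (P.del 2) weyl (rowVec τ 0) :=
  (isEquivariantFamily_upper τ hτ).zero_eq_psi_weyl

lemma colVec_zero_eq_psi_weyl (hτ : τ.IsGL3ZInvariant) :
    colVec τ 0 = psi P.mu23 (P.del 0) weyl (colVec τ 0) := by
  refine LinearMap.ext fun F => ?_
  rw [psi_apply, ← reflect_reflect (colVec τ 0), reflect_apply, reflect_apply]
  -- The reflection conjugates `weyl` to its inverse.
  refine (isEquivariantFamily_lower τ hτ).zero_eq (α := 0) (β := -1) (γ := 1) (d := 0)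
    (by norm_num) _ _ fun v => ?_
  simp only [pullback_apply]
  refine congrArg F.1 (Prod.ext ?_ ?_) <;> simp [act2, weyl]

lemma rowVec_zero_eq_zero (hτ : τ.IsGL3ZInvariant) (h : P.del 2 = 1) : rowVec τ 0 = 0 :=
  (isEquivariantFamily_upper τ hτ).zero_eq_zero h

lemma colVec_zero_eq_zero (hτ : τ.IsGL3ZInvariant) (h : P.del 0 = 1) : colVec τ 0 = 0 := by
  have h1 : reflect _ _ (colVec τ 0) = 0 := (isEquivariantFamily_lower τ hτ).zero_eq_zero h
  rw [← reflect_reflect (colVec τ 0), h1]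
  rfl

end Components

/-- For a vector of even parity fixed by the Weyl element, the trigonometric series of its restriction
to the line has, away from `0`, the same sum as the series transformed by `x ↦ -1/x`. -/
lemma hasSum_of_eq_psi_weyl {μ : ℂ} {η : ZMod 2} {S : SL2Functional μ η} (hη : η = 0)
    (hS : S = psi μ η weyl S) {d : ℤ → ℂ}
    (hd : ∀ φ : Test ℝ, HasSum (fun r : ℤ => d r * ∫ x : ℝ, e (r * x) * φ x) (restrictLine S φ))
    (φ : Test ℝ) (hφ : (0 : ℝ) ∉ tsupport φ) :
    HasSum (fun r : ℤ => d r * ∫ x : ℝ, ((|x| : ℝ) : ℂ) ^ (μ - 1) * e (-(r / x)) * φ x)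
      (restrictLine S φ) := by
  rw [weyl_eq_cuspMatrix] at hS
  have h := hasSum_restrictLine_of_psi_cuspMatrix _ hS hd φ hφ
  refine (congrArg (fun f => HasSum f _) (funext fun r => ?_)).mpr h
  congr 1
  refine MeasureTheory.integral_congr_ae (Filter.Eventually.of_forall fun x => ?_)
  simp [quasiChar, hη]

end GL3Automorphic

end

theorem proposition3p4 (P : Params) (τ : P.Dist) (hτ : τ.IsGL3ZInvariant) :
    -- a) and b), as identities of distributions on `ℝ - {0}`
    (∀ q a abar c : ℤ, q ≠ 0 → c ≠ 0 → a * abar ≡ 1 [ZMOD c] →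
      ∀ φ : Test ℝ, (0 : ℝ) ∉ tsupport φ →
        HasSum (fun r : ℤ => abelianCoeff τ r q *
            ∫ x : ℝ, quasiChar (P.del 2) (P.lam 0 - P.lam 1 - 1) (c * x) *
              e (r * abar / c - r / (c ^ 2 * x)) * φ x)
          (sigma τ (c * q) (a * q) φ) ∧
        HasSum (fun s : ℤ => abelianCoeff τ q s *
            ∫ y : ℝ, quasiChar (P.del 0) (P.lam 1 - P.lam 2 - 1) (c * y) *
              e (s / (c ^ 2 * y) - s * abar / c) * φ y)
          (rho τ (c * q) (a * q) φ)) ∧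
    -- c) and d), as identities of distributions on `ℝ - {0}`
    (∀ φ : Test ℝ, (0 : ℝ) ∉ tsupport φ →
      (P.del 2 = 0 → ∃ v : ℂ,
        HasSum (fun r : ℤ => abelianCoeff τ r 0 * ∫ x : ℝ, e (r * x) * φ x) v ∧
        HasSum (fun r : ℤ => abelianCoeff τ r 0 *
          ∫ x : ℝ, ((|x| : ℝ) : ℂ) ^ (P.lam 0 - P.lam 1 - 1) * e (-(r / x)) * φ x) v) ∧
      (P.del 2 = 1 →
        HasSum (fun r : ℤ => abelianCoeff τ r 0 * ∫ x : ℝ, e (r * x) * φ x) 0) ∧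
      (P.del 0 = 0 → ∃ v : ℂ,
        HasSum (fun s : ℤ => abelianCoeff τ 0 s * ∫ y : ℝ, e (s * y) * φ y) v ∧
        HasSum (fun s : ℤ => abelianCoeff τ 0 s *
          ∫ y : ℝ, ((|y| : ℝ) : ℂ) ^ (P.lam 1 - P.lam 2 - 1) * e (-(s / y)) * φ y) v) ∧
      (P.del 0 = 1 →
        HasSum (fun s : ℤ => abelianCoeff τ 0 s * ∫ y : ℝ, e (s * y) * φ y) 0)) ∧
    -- the extensions to vectors in the principal series of `SL(2, ℝ)`
    (∀ n k : ℤ, n ≠ 0 →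
      IsSL2DistVector (sigmaVec τ n k) ∧ restrictLine (sigmaVec τ n k) = sigma τ n k ∧
      IsSL2DistVector (rhoVec τ n k) ∧ restrictLine (rhoVec τ n k) = rho τ n k ∧
      sigmaVec τ n (k + n) = sigmaVec τ n k ∧ rhoVec τ n (k + n) = rhoVec τ n k) ∧
    (∀ q : ℤ,
      IsSL2DistVector (rowVec τ q) ∧
      (∀ φ : Test ℝ, HasSum (fun r : ℤ => abelianCoeff τ r q * ∫ x : ℝ, e (r * x) * φ x)
        (restrictLine (rowVec τ q) φ)) ∧
      IsSL2DistVector (colVec τ q) ∧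
      (∀ φ : Test ℝ, HasSum (fun s : ℤ => abelianCoeff τ q s * ∫ y : ℝ, e (s * y) * φ y)
        (restrictLine (colVec τ q) φ))) ∧
    -- the identities between these vectors
    (∀ (q a abar c : ℤ) (hc : c ≠ 0), q ≠ 0 → a * abar ≡ 1 [ZMOD c] →
      rowVec τ q =
        psi (P.lam 0 - P.lam 1) (P.del 2) (cuspMatrix abar c hc) (sigmaVec τ (c * q) (a * q)) ∧
      reflect (P.lam 1 - P.lam 2) (P.del 0) (colVec τ q) =
        psi (P.lam 1 - P.lam 2) (P.del 0) (cuspMatrix abar c hc) (rhoVec τ (c * q) (a * q)) ∧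
      ∀ abar' : ℤ, abar' ≡ abar [ZMOD c] →
        psi (P.lam 0 - P.lam 1) (P.del 2) (cuspMatrix abar' c hc) (sigmaVec τ (c * q) (a * q)) =
          psi (P.lam 0 - P.lam 1) (P.del 2) (cuspMatrix abar c hc) (sigmaVec τ (c * q) (a * q)) ∧
        psi (P.lam 1 - P.lam 2) (P.del 0) (cuspMatrix abar' c hc) (rhoVec τ (c * q) (a * q)) =
          psi (P.lam 1 - P.lam 2) (P.del 0) (cuspMatrix abar c hc) (rhoVec τ (c * q) (a * q))) ∧
    (P.del 2 = 0 → rowVec τ 0 = psi (P.lam 0 - P.lam 1) (P.del 2) weyl (rowVec τ 0)) ∧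
    (P.del 0 = 0 → colVec τ 0 = psi (P.lam 1 - P.lam 2) (P.del 0) weyl (colVec τ 0)) := by
  have hcongr : ∀ {a abar abar' c : ℤ}, a * abar ≡ 1 [ZMOD c] → abar' ≡ abar [ZMOD c] →
      a * abar' ≡ 1 [ZMOD c] := fun h h' => (h'.mul_left _).trans h
  refine ⟨fun q a abar c hq hc ha φ hφ => ⟨?_, ?_⟩, fun φ hφ => ⟨fun h => ?_, fun h => ?_,
    fun h => ?_, fun h => ?_⟩, fun n k hn => ⟨?_, restrictLine_sigmaVec τ n k, ?_,
    restrictLine_rhoVec τ n k, ?_, ?_⟩, fun q => ⟨?_, hasSum_rowVec hτ q, ?_, hasSum_colVec hτ q⟩,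
    fun q a abar c hc hq ha => ⟨rowVec_eq_psi_cuspMatrix hτ hc hq ha,
      reflect_colVec_eq_psi_cuspMatrix hτ hc hq ha, fun abar' h => ⟨?_, ?_⟩⟩,
    fun _ => rowVec_zero_eq_psi_weyl hτ, fun _ => colVec_zero_eq_psi_weyl hτ⟩
  · rw [← restrictLine_sigmaVec]
    exact hasSum_restrictLine_of_psi_cuspMatrix hc (rowVec_eq_psi_cuspMatrix hτ hc hq ha)
      (hasSum_rowVec hτ q) φ hφ
  · rw [← restrictLine_rhoVec]
    -- The series of the reflected vector is indexed by `r = -s`.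
    have h := hasSum_restrictLine_of_psi_cuspMatrix hc
      (reflect_colVec_eq_psi_cuspMatrix hτ hc hq ha) (hasSum_reflect_colVec hτ q) φ hφ
    refine (Equiv.neg ℤ).hasSum_iff.1 ((congrArg (fun f => HasSum f _) (funext fun r => ?_)).mpr h)
    simp only [Function.comp_apply, Equiv.neg_apply]
    congr 1
    refine MeasureTheory.integral_congr_ae (Filter.Eventually.of_forall fun y => ?_)
    have harg : ((-r : ℤ) : ℝ) / (c ^ 2 * y) - ((-r : ℤ) : ℝ) * abar / c =
        r * abar / c - r / (c ^ 2 * y) := by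
      push_cast
      ring
    simp only [harg]
    rfl
  · exact ⟨_, hasSum_rowVec hτ 0 φ,
      hasSum_of_eq_psi_weyl h (rowVec_zero_eq_psi_weyl hτ) (hasSum_rowVec hτ 0) φ hφ⟩
  · have h1 := hasSum_rowVec hτ 0 φ
    rwa [rowVec_zero_eq_zero hτ h] at h1
  · exact ⟨_, hasSum_colVec hτ 0 φ,
      hasSum_of_eq_psi_weyl h (colVec_zero_eq_psi_weyl hτ) (hasSum_colVec hτ 0) φ hφ⟩
  · have h1 := hasSum_colVec hτ 0 φ
    rwa [colVec_zero_eq_zero hτ h] at h1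
  · exact (isSL2DistVector_upperFamily τ (torusTest k n)).psi _
  · exact (isSL2DistVector_lowerFamily τ (torusTest k n)).reflect.psi _
  · exact (isEquivariantFamily_upper τ hτ).psi_unip_add hn k
  · exact (isEquivariantFamily_lower τ hτ).psi_unip_add hn k
  · exact isSL2DistVector_upperFamily τ (torusTest q 0)
  · exact isSL2DistVector_lowerFamily τ (torusTest q 0)
  · exact (rowVec_eq_psi_cuspMatrix hτ hc hq (hcongr ha h)).symm.trans
      (rowVec_eq_psi_cuspMatrix hτ hc hq ha)
  · exact (reflect_colVec_eq_psi_cuspMatrix hτ hc hq (hcongr ha h)).symm.trans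
      (reflect_colVec_eq_psi_cuspMatrix hτ hc hq ha)
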